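/- Let $(R,m_R)$ be a Noetherian local domain of dimension $d$ with quotient field $K$. Let $P_R$ be its Hilbert–Samuel polynomial, i.e. the polynomial with $\ell(R/m_R^n)=P_R(n)$ for $n\gg0$, and let $e(R)$ be its multiplicity, so that $P_R(n)=\frac{e(R)}{d!}n^d+$ lower order terms. Let $\nu$ be a rank $1$ valuation of $K$, with values in $\mathbb R$, whose valuation ring $(V,m_V)$ dominates $R$ (that is, $R\subset V$ and $m_V\cap R=m_R$). Assume that $R$ contains an infinite field $k$ which maps isomorphically onto $R/m_R$, and that the induced map $R/m_R\to V/m_V$ is an isomorphism. Let $S^R(\nu)=\nu(m_R\setminus\{0\})$, normalized so that its smallest element is $1$, and for $n\in\mathbb N$ let $\phi(n)=|S^R(\nu)\cap(0,n)|$. If the first $d$ elements of $S^R(\nu)$ are $1=s_1<s_2<\dots<s_d$, then $$\limsup_{n\to\infty}\frac{\phi(n)}{n^d}\le\frac{e(R)}{d!}\cdot\frac{1}{s_1\cdots s_d},$$ and thus, if $d>1$, $$\limsup_{n\to\infty}\frac{\phi(n)}{n^d}<\frac{e(R)}{d!}=\lim_{n\to\infty}\frac{P_R(n)}{n^d}.$$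 -/

import Mathlib

open Filter Topology IsLocalRing
open scoped Nat ENNReal

namespace ValueSemigroup

noncomputable section

/-- `P` agrees with the Hilbert-Samuel function `n ↦ ℓ(R/m_R^n)` for all large `n`. -/
def IsHilbertSamuelPoly (R : Type*) [CommRing R] [IsLocalRing R] (P : Polynomial ℚ) : Prop :=
  ∀ᶠ n : ℕ in atTop, ∃ l : ℕ,
    Module.length R (R ⧸ maximalIdeal R ^ n) = (l : ℕ∞) ∧ P.eval (n : ℚ) = (l : ℚ)

open Classical in
/-- The Hilbert-Samuel polynomial `P_R` of a Noetherian local ring: the (unique) polynomial with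
`ℓ(R/m_R^n) = P_R(n)` for `n ≫ 0`. -/
def hilbertSamuelPoly (R : Type*) [CommRing R] [IsLocalRing R] : Polynomial ℚ :=
  if h : ∃ P : Polynomial ℚ, IsHilbertSamuelPoly R P then h.choose else 0

/-- The Krull dimension of a Noetherian local ring, as a natural number. -/
def dim (R : Type*) [CommRing R] : ℕ := ((ringKrullDim R).unbotD 0).toNat

/-- The multiplicity `e(R)`: `P_R(n) = (e(R)/d!) n^d + lower order terms`, with `d = dim R`. -/
def multiplicity (R : Type*) [CommRing R] [IsLocalRing R] : ℚ :=
  ((dim R)! : ℚ) * (hilbertSamuelPoly R).coeff (dim R)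

section

variable (R : Type*) [CommRing R] [IsLocalRing R] {K : Type*} [Field K] [Algebra R K]

/-- The valuation ring `V = {x ∈ K | ν(x) ≥ 0}` of a real-valued valuation `ν`. -/
abbrev valuationRing {K : Type*} [Field K] (ν : AddValuation K (WithTop ℝ)) :
    ValuationSubring K :=
  ν.toValuation.valuationSubring

/-- `ν` dominates `R`: `R ⊆ V` and `m_V ∩ R = m_R`. -/
structure Dominates (ν : AddValuation K (WithTop ℝ)) : Prop where
  mem : ∀ r : R, algebraMap R K r ∈ valuationRing ν
  comap_eq : Ideal.comap
    ((algebraMap R K).codRestrict (valuationRing ν).toSubring mem : R →+* valuationRing ν)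
    (maximalIdeal (valuationRing ν)) = maximalIdeal R

variable {R}

/-- The inclusion `R → V`. -/
def Dominates.inclusion {ν : AddValuation K (WithTop ℝ)} (h : Dominates R ν) :
    R →+* valuationRing ν :=
  (algebraMap R K).codRestrict (valuationRing ν).toSubring h.mem

theorem Dominates.isLocalHom {ν : AddValuation K (WithTop ℝ)} (h : Dominates R ν) :
    IsLocalHom h.inclusion :=
  ((local_hom_TFAE h.inclusion).out 0 4).mpr h.comap_eq

/-- The induced embedding of residue fields `R/m_R → V/m_V`. -/
def Dominates.residueFieldMap {ν : AddValuation K (WithTop ℝ)} (h : Dominates R ν) :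
    ResidueField R →+* ResidueField (valuationRing ν) :=
  haveI := h.isLocalHom
  ResidueField.map h.inclusion

variable (R)

/-- The value semigroup `S^R(ν) = ν(m_R ∖ {0})`. -/
def valueSemigroup (ν : AddValuation K (WithTop ℝ)) : Set ℝ :=
  {s | ∃ f ∈ maximalIdeal R, f ≠ 0 ∧ ν (algebraMap R K f) = (s : WithTop ℝ)}

/-- `φ(n) = |S^R(ν) ∩ (0, n)|`, a priori possibly infinite. -/
def phi (ν : AddValuation K (WithTop ℝ)) (n : ℕ) : ℕ∞ :=
  (valueSemigroup R ν ∩ Set.Ioo 0 (n : ℝ)).encard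

end

/-- `s` lists the first `d` elements of `S` in increasing order: each `s i` is the least element
of `S` different from all the earlier ones. -/
def IsFirstElements {d : ℕ} (S : Set ℝ) (s : Fin d → ℝ) : Prop :=
  ∀ i : Fin d, IsLeast (S \ s '' Set.Iio i) (s i)

end

end ValueSemigroup

/-! ### Lengths of cyclic modules `R/N`. -/

section Length

variable {R : Type*} [CommRing R]

/-! Write `m` for the maximal ideal of `R`. Since the residue field is infinite, `m` has a reduction
`Q` generated by `d` elements `y_i` (`exists_minimal_reduction`). Since `R` and `V` have the same
residue field, elimination on these generators, which does not change `Q`, achieves `ν(y_i) ≥ s_i`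
(`Dominates.exists_generators_le`).

As `Q` is a reduction, there are finitely many `g_j` of degree `δ_j` such that the products `y^a
g_j` with `|a| + δ_j = n` generate `m^n` for every `n` (`exists_generatesPowers`). Discarding those
that depend on earlier ones leaves the standard elements, which form a basis of each `m^n/m^(n+1)`,
so `ℓ(R/m^n)` is the number of standard elements of degree less than `n`. For fixed `j` the standard
exponents form a lower set of `ℕ^d`. It contributes `n^d/d!` to leading order if it is all of `ℕ^d`,
and nothing in degree `d` otherwise. Hence `e(R)` is the number of `j` of the first kind, called
`rank`.

Let `I_n` be the ideal of elements of value at least `n`; it contains `m^n` because values on `m`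
are at least 1. Then `φ(n) ≤ ℓ(R/I_n)`, and `ℓ(R/I_n)` is at most the number of standard elements
outside `I_n`. For such an element `∑ a_i s_i < n`, so each full `j` contributes at most about
`n^d/(d! s_1⋯s_d)` and the other `j` contribute `o(n^d)`. This is the bound.

It is strict for `d > 1` because `s_2 > 1` and `e(R) > 0`. The latter holds because the generators
of a minimal reduction are analytically independent: all `y^a` are standard
(`GeneratesPowers.isStd_zero`). -/

theorem length_quotient_anti {I J : Ideal R} (h : I ≤ J) :
    Module.length R (R ⧸ J) ≤ Module.length R (R ⧸ I) :=
  Module.length_le_of_surjective (Submodule.factor h) (Submodule.factor_surjective h)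

theorem length_quotient_congr {I J : Ideal R} (h : I = J) :
    Module.length R (R ⧸ I) = Module.length R (R ⧸ J) := by
  rw [h]

/-- Length is additive along the exact sequence `R/(N : x) → R/N → R/(N + xR)`. -/
theorem length_quotient_eq_add (N : Ideal R) (x : R) :
    Module.length R (R ⧸ N) =
      Module.length R (R ⧸ LinearMap.ker (LinearMap.toSpanSingleton R (R ⧸ N) (N.mkQ x))) +
        Module.length R (R ⧸ (N ⊔ Ideal.span {x})) := by
  set f := LinearMap.toSpanSingleton R (R ⧸ N) (N.mkQ x) with hf
  refine Module.length_eq_add_of_exact ((LinearMap.ker f).liftQ f le_rfl)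
    (Submodule.factor (le_sup_left : N ≤ N ⊔ Ideal.span {x}))
    (LinearMap.ker_eq_bot.mp (Submodule.ker_liftQ_eq_bot _ _ _ le_rfl))
    (Submodule.factor_surjective _) ?_
  rw [LinearMap.exact_iff, Submodule.range_liftQ, hf, LinearMap.range_toSpanSingleton]
  ext z
  obtain ⟨z, rfl⟩ := N.mkQ_surjective z
  rw [LinearMap.mem_ker, Submodule.mem_span_singleton]
  have : (Submodule.factor (le_sup_left : N ≤ N ⊔ Ideal.span {x})) (N.mkQ z) =
      (N ⊔ Ideal.span {x}).mkQ z := rfl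
  rw [this, Submodule.mkQ_apply, Submodule.Quotient.mk_eq_zero, Submodule.mem_sup]
  constructor
  · rintro ⟨n, hn, w, hw, rfl⟩
    obtain ⟨c, rfl⟩ := Ideal.mem_span_singleton'.mp hw
    refine ⟨c, ?_⟩
    rw [← map_smul, Submodule.mkQ_apply, Submodule.mkQ_apply, Submodule.Quotient.eq]
    simpa using hn
  · rintro ⟨c, hc⟩
    rw [← map_smul, Submodule.mkQ_apply, Submodule.mkQ_apply, Submodule.Quotient.eq] at hc
    refine ⟨z - c • x, by simpa using N.neg_mem hc, c • x,
      Ideal.mem_span_singleton'.mpr ⟨c, rfl⟩, by ring⟩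

theorem mem_ker_toSpanSingleton_mkQ {N : Ideal R} {x c : R} :
    c ∈ LinearMap.ker (LinearMap.toSpanSingleton R (R ⧸ N) (N.mkQ x)) ↔ c * x ∈ N := by
  rw [LinearMap.mem_ker, LinearMap.toSpanSingleton_apply, ← map_smul, Submodule.mkQ_apply,
    Submodule.Quotient.mk_eq_zero, smul_eq_mul]

/-- The hypothesis says `q ⊆ (N : x)`, so the left term of the exact sequence is a quotient of
`R/q`. -/
theorem length_quotient_le_add {N q : Ideal R} {x : R} (h : ∀ c ∈ q, c * x ∈ N) :
    Module.length R (R ⧸ N) ≤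
      Module.length R (R ⧸ q) + Module.length R (R ⧸ (N ⊔ Ideal.span {x})) := by
  rw [length_quotient_eq_add N x]
  gcongr
  exact length_quotient_anti fun c hc => mem_ker_toSpanSingleton_mkQ.mpr (h c hc)

theorem one_add_length_quotient_le {N : Ideal R} {x : R} (h : x ∉ N) :
    1 + Module.length R (R ⧸ (N ⊔ Ideal.span {x})) ≤ Module.length R (R ⧸ N) := by
  rw [length_quotient_eq_add N x]
  gcongr
  rw [Order.one_le_iff_pos, Module.length_pos_iff, ← not_subsingleton_iff_nontrivial,
    Submodule.Quotient.subsingleton_iff, Ideal.eq_top_iff_one, mem_ker_toSpanSingleton_mkQ]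
  simpa using h

theorem length_quotient_maximalIdeal [IsLocalRing R] :
    Module.length R (R ⧸ maximalIdeal R) = 1 := by
  rw [Module.length_eq_one_iff, isSimpleModule_iff_isCoatom]
  exact (maximalIdeal.isMaximal R).out

theorem length_quotient_eq_one_add [IsLocalRing R] {N : Ideal R} {x : R} (h : x ∉ N)
    (hx : ∀ c ∈ maximalIdeal R, c * x ∈ N) :
    Module.length R (R ⧸ N) = 1 + Module.length R (R ⧸ (N ⊔ Ideal.span {x})) :=
  le_antisymm (by simpa [length_quotient_maximalIdeal] using length_quotient_le_add hx)
    (one_add_length_quotient_le h)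

section

variable {ι : Type*} [DecidableEq ι]

theorem sup_span_image_insert (N : Ideal R) (x : ι → R) (a : ι) (s : Finset ι) :
    N ⊔ Ideal.span (x '' (insert a s : Finset ι)) =
      N ⊔ Ideal.span (x '' s) ⊔ Ideal.span {x a} := by
  rw [Finset.coe_insert, Set.image_insert_eq, Ideal.span_insert, sup_assoc, sup_comm (Ideal.span {x a})]

theorem length_quotient_le_card_mul_add (N q : Ideal R) (x : ι → R) (s : Finset ι)
    (h : ∀ i ∈ s, ∀ c ∈ q, c * x i ∈ N) :
    Module.length R (R ⧸ N) ≤ s.card * Module.length R (R ⧸ q) +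
      Module.length R (R ⧸ (N ⊔ Ideal.span (x '' s))) := by
  induction s using Finset.induction_on with
  | empty => simpa using length_quotient_anti (by simp)
  | insert a s ha ih =>
    refine (ih fun i hi => h i (Finset.mem_insert_of_mem hi)).trans ?_
    rw [sup_span_image_insert, Finset.card_insert_of_notMem ha]
    have := length_quotient_le_add (N := N ⊔ Ideal.span (x '' s))
      fun c hc => le_sup_left (a := N) (h a (Finset.mem_insert_self _ _) c hc)
    push_cast
    rw [add_mul, one_mul, add_assoc]
    gcongr

end

variable {ι : Type*} [LinearOrder ι]

open Classical in
/-- Adjoining to `N` finitely many elements killed by the maximal ideal modulo `N`, the length of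
the quotient drops by the number of elements that do not lie in the span of the earlier ones. -/
theorem length_quotient_eq_card_add [IsLocalRing R] (N : Ideal R) (x : ι → R) (s : Finset ι)
    (h : ∀ i ∈ s, ∀ c ∈ maximalIdeal R, c * x i ∈ N) :
    Module.length R (R ⧸ N) =
      (s.filter fun i => x i ∉ N ⊔ Ideal.span (x '' {j | j ∈ s ∧ j < i})).card +
        Module.length R (R ⧸ (N ⊔ Ideal.span (x '' s))) := by
  -- Adding the largest index last leaves the sets of predecessors of the other indices unchanged.
  induction s using Finset.induction_on_max with
  | empty => simp [length_quotient_congr (show N ⊔ Ideal.span (x '' (∅ : Finset ι)) = N by simp)]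
  | insert a s has ih =>
    have ha : a ∉ s := fun h => (has a h).false
    specialize ih fun i hi => h i (Finset.mem_insert_of_mem hi)
    have h1 : {j | j ∈ insert a s ∧ j < a} = (s : Set ι) := by
      ext j
      simp only [Finset.mem_insert, Set.mem_ofPred_eq, Finset.mem_coe]
      exact ⟨fun h => h.1.resolve_left h.2.ne, fun h => ⟨Or.inr h, has j h⟩⟩
    have h2 : ∀ i ∈ s, {j | j ∈ insert a s ∧ j < i} = {j | j ∈ s ∧ j < i} := by
      intro i hi
      ext j
      simp only [Finset.mem_insert, Set.mem_ofPred_eq]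
      exact ⟨fun h => ⟨h.1.resolve_left (h.2.trans (has i hi)).ne, h.2⟩,
        fun h => ⟨Or.inr h.1, h.2⟩⟩
    have h3 : (s.filter fun i => x i ∉ N ⊔ Ideal.span (x '' {j | j ∈ insert a s ∧ j < i})) =
        s.filter fun i => x i ∉ N ⊔ Ideal.span (x '' {j | j ∈ s ∧ j < i}) :=
      Finset.filter_congr fun i hi => by rw [h2 i hi]
    rw [Finset.filter_insert, h1, h3, length_quotient_congr (sup_span_image_insert N x a s), ih]
    by_cases hxa : x a ∈ N ⊔ Ideal.span (x '' s)
    · rw [if_neg (not_not.mpr hxa)]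
      rw [length_quotient_congr (sup_eq_left.mpr ((Ideal.span_singleton_le_iff_mem _).mpr hxa))]
    · rw [if_pos hxa, Finset.card_insert_of_notMem (by simp [ha]), length_quotient_eq_one_add hxa
        fun c hc => le_sup_left (a := N) (h a (Finset.mem_insert_self _ _) c hc)]
      push_cast
      ring

/-- A strictly decreasing chain of ideals bounds the length from below. -/
theorem card_le_length_quotient (N : Ideal R) (x : ι → R) (s : Finset ι)
    (h : ∀ i ∈ s, x i ∉ N ⊔ Ideal.span (x '' {j | j ∈ s ∧ j < i})) :
    (s.card : ℕ∞) ≤ Module.length R (R ⧸ N) := by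
  suffices H : (s.card : ℕ∞) + Module.length R (R ⧸ (N ⊔ Ideal.span (x '' s))) ≤
      Module.length R (R ⧸ N) from le_self_add.trans H
  induction s using Finset.induction_on_max with
  | empty => simp [length_quotient_congr (show N ⊔ Ideal.span (x '' (∅ : Finset ι)) = N by simp)]
  | insert a s has ih =>
    have ha : a ∉ s := fun h => (has a h).false
    rw [sup_span_image_insert, Finset.card_insert_of_notMem ha]
    have h1 : {j | j ∈ insert a s ∧ j < a} = (s : Set ι) := by
      ext j
      simp only [Finset.mem_insert, Set.mem_ofPred_eq, Finset.mem_coe]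
      exact ⟨fun h => h.1.resolve_left h.2.ne, fun h => ⟨Or.inr h, has j h⟩⟩
    have h2 := h a (Finset.mem_insert_self _ _)
    rw [h1] at h2
    refine le_trans ?_ (ih fun i hi hx => h i (Finset.mem_insert_of_mem hi) ?_)
    · push_cast
      rw [add_assoc]
      gcongr
      exact one_add_length_quotient_le h2
    · refine sup_le_sup_left (Ideal.span_mono (Set.image_mono ?_)) N hx
      exact fun j hj => ⟨Finset.mem_insert_of_mem hj.1, hj.2⟩

end Length

/-! ### Lattice points: Hilbert functions of monomial ideals and weighted simplices. -/

section Counting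

open Polynomial

theorem finite_setOf_sum_lt (d n : ℕ) : {a : Fin d → ℕ | ∑ i, a i < n}.Finite := by
  refine (Set.finite_Iic fun _ => n).subset fun a ha i => ?_
  exact (Finset.single_le_sum (fun _ _ => Nat.zero_le _) (Finset.mem_univ i)).trans
    (show ∑ i, a i < n from ha).le

/-- Stars and bars. -/
theorem ncard_setOf_sum_le (d n : ℕ) : {a : Fin d → ℕ | ∑ i, a i ≤ n}.ncard = (n + d).choose d := by
  have hfin : ∀ d n : ℕ, {a : Fin d → ℕ | ∑ i, a i ≤ n}.Finite := fun d n => by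
    simpa [Nat.lt_succ_iff] using finite_setOf_sum_lt d (n + 1)
  induction d generalizing n with
  | zero =>
    rw [Nat.choose_zero_right, Set.ncard_eq_one]
    exact ⟨0, by ext a; simp [Subsingleton.elim a 0]⟩
  | succ d ihd =>
    -- Pascal's rule: either the first coordinate is zero and can be dropped, or it can be lowered
    -- by one.
    have split : ∀ n, {a : Fin (d + 1) → ℕ | ∑ i, a i ≤ n} =
        (Fin.cons (n := d) (α := fun _ => ℕ) 0) '' {a | ∑ i, a i ≤ n} ∪
          {a | a 0 ≠ 0 ∧ ∑ i, a i ≤ n} := by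
      intro n
      ext a
      constructor
      · intro ha
        by_cases h0 : a 0 = 0
        · refine Or.inl ⟨Fin.tail a, ?_, ?_⟩
          · have : ∑ i, a i ≤ n := ha
            simpa [Fin.sum_univ_succ, h0, Fin.tail] using this
          · rw [← h0]; exact Fin.cons_self_tail a
        · exact Or.inr ⟨h0, ha⟩
      · rintro (⟨b, hb, rfl⟩ | h)
        · simpa [Fin.sum_univ_succ] using hb
        · exact h.2
    have hdisj : ∀ n, Disjoint ((Fin.cons (n := d) (α := fun _ => ℕ) 0) '' {a | ∑ i, a i ≤ n})
        {a | a 0 ≠ 0 ∧ ∑ i, a i ≤ n} := by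
      intro n
      rw [Set.disjoint_left]
      rintro _ ⟨b, hb, rfl⟩ h
      exact h.1 (by simp)
    have hcard : ∀ n, {a : Fin (d + 1) → ℕ | ∑ i, a i ≤ n}.ncard = (n + d).choose d +
        {a : Fin (d + 1) → ℕ | a 0 ≠ 0 ∧ ∑ i, a i ≤ n}.ncard := by
      intro n
      rw [split n, Set.ncard_union_eq (hdisj n) ((hfin d n).image _)
        ((hfin (d + 1) n).subset fun a ha => ha.2),
        Set.ncard_image_of_injective _ (Fin.cons_right_injective 0), ihd]
    induction n with
    | zero =>
      have : {a : Fin (d + 1) → ℕ | a 0 ≠ 0 ∧ ∑ i, a i ≤ 0} = ∅ := by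
        ext a
        simp only [Set.mem_ofPred_eq, Set.mem_empty_iff_false, iff_false, not_and]
        intro h h'
        rw [Fin.sum_univ_succ] at h'
        omega
      rw [hcard, this]
      simp
    | succ n ihn =>
      rw [hcard]
      have : {a : Fin (d + 1) → ℕ | a 0 ≠ 0 ∧ ∑ i, a i ≤ n + 1} =
          (fun a => a + Pi.single 0 1) '' {a : Fin (d + 1) → ℕ | ∑ i, a i ≤ n} := by
        ext a
        constructor
        · rintro ⟨h0, h⟩
          have hs : Pi.single 0 1 ≤ a := by
            intro i
            rcases Fin.eq_zero_or_eq_succ i with rfl | ⟨j, rfl⟩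
            · simp; omega
            · simp
          obtain ⟨b, rfl⟩ := exists_add_of_le hs
          refine ⟨b, ?_, add_comm _ _⟩
          simp only [Pi.add_apply, Finset.sum_add_distrib, Finset.sum_pi_single', Finset.mem_univ,
            if_true] at h
          show ∑ i, b i ≤ n
          omega
        · rintro ⟨b, hb, rfl⟩
          refine ⟨by simp, ?_⟩
          have : ∑ i, b i ≤ n := hb
          simpa [Finset.sum_add_distrib] using this
      rw [this, Set.ncard_image_of_injective _ (add_left_injective _), ihn]
      rw [show n + 1 + (d + 1) = (n + 1 + d) + 1 by ring, Nat.choose_succ_succ,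
        show n + (d + 1) = n + 1 + d by ring]

/-- The strict inequality means `|a| ≤ n - 1`, so the count is the binomial coefficient of `n - 1 +
d` over `d`; this is the shift by 1 in `preHilbertPoly`. -/
theorem exists_polynomial_simplex (d : ℕ) : ∃ p : ℚ[X], p.natDegree ≤ d ∧
    p.coeff d = (d ! : ℚ)⁻¹ ∧
      ∀ n : ℕ, 1 ≤ n → ({a : Fin d → ℕ | ∑ i, a i < n}.ncard : ℚ) = p.eval (n : ℚ) := by
  refine ⟨preHilbertPoly ℚ d 1, (natDegree_preHilbertPoly ℚ d 1).le,
    coeff_preHilbertPoly_self ℚ d 1, fun n hn => ?_⟩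
  rw [preHilbertPoly_eq_choose_sub_add ℚ d hn, ← ncard_setOf_sum_le]
  congr 3
  ext a
  omega

theorem coeff_comp_X_sub_C {p : ℚ[X]} {d : ℕ} (hp : p.natDegree ≤ d) (c : ℚ) :
    (p.comp (X - C c)).natDegree ≤ d ∧ (p.comp (X - C c)).coeff d = p.coeff d := by
  have h1 : (p.comp (X - C c)).natDegree = p.natDegree := by
    rw [natDegree_comp, natDegree_X_sub_C, mul_one]
  refine ⟨h1 ▸ hp, ?_⟩
  rcases hp.eq_or_lt with rfl | h
  · have := leadingCoeff_comp (p := p) (q := X - C c) (by simp)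
    rwa [leadingCoeff, h1, leadingCoeff_X_sub_C, one_pow, mul_one] at this
  · rw [coeff_eq_zero_of_natDegree_lt h, coeff_eq_zero_of_natDegree_lt (h1 ▸ h)]

/-- The Hilbert function of a monomial ideal, given by the exponents of its generators. -/
theorem exists_polynomial_list (d : ℕ) : ∀ (k : ℕ) (l : List (Fin d → ℕ)), l.length = k →
    ∃ p : ℚ[X], p.natDegree ≤ d ∧ p.coeff d = (if k = 0 then (d ! : ℚ)⁻¹ else 0) ∧
      ∀ᶠ n : ℕ in atTop,
        ({a : Fin d → ℕ | (∀ f ∈ l, ¬ f ≤ a) ∧ ∑ i, a i < n}.ncard : ℚ) = p.eval (n : ℚ) := by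
  intro k
  induction k with
  | zero =>
    intro l hl
    obtain rfl := List.eq_nil_of_length_eq_zero hl
    obtain ⟨p, h1, h2, h3⟩ := exists_polynomial_simplex d
    refine ⟨p, h1, by simpa using h2, ?_⟩
    filter_upwards [eventually_ge_atTop 1] with n hn
    simpa using h3 n hn
  | succ k ih =>
    intro l hl
    obtain ⟨b, l, rfl⟩ := List.exists_cons_of_length_eq_add_one hl
    have hl' : l.length = k := by simpa using hl
    obtain ⟨p, p1, p2, p3⟩ := ih l hl'
    -- The exponents to be removed are those of the form `b + c`. With truncated subtraction, `f ≤ b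
    -- + c` iff `f - b ≤ c`, so they are counted by the shorter list `l.map (· - b)` in degree `n -
    -- |b|`. Both counts have the same coefficient in degree `d`, which cancels.
    obtain ⟨q, q1, q2, q3⟩ := ih (l.map (· - b)) (by simpa using hl')
    obtain ⟨r1, r2⟩ := coeff_comp_X_sub_C q1 ((∑ i, b i : ℕ) : ℚ)
    refine ⟨p - q.comp (X - C ((∑ i, b i : ℕ) : ℚ)), (natDegree_sub_le_of_le p1 r1).trans (by simp),
      by rw [coeff_sub, r2, p2, q2]; simp, ?_⟩
    filter_upwards [p3, (tendsto_sub_atTop_nat (∑ i, b i)).eventually q3,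
      eventually_ge_atTop (∑ i, b i)] with n hp hq hn
    rw [eval_sub, eval_comp, eval_sub, eval_X, eval_C, ← hp, ← Nat.cast_sub hn, ← hq,
      eq_sub_iff_add_eq]
    norm_cast
    have himg : {a : Fin d → ℕ | b ≤ a ∧ (∀ f ∈ l, ¬ f ≤ a) ∧ ∑ i, a i < n} =
        (· + b) '' {a : Fin d → ℕ | (∀ f ∈ l.map (· - b), ¬ f ≤ a) ∧ ∑ i, a i < n - ∑ i, b i} := by
      ext a
      constructor
      · rintro ⟨hb, h1, h2⟩
        obtain ⟨c, rfl⟩ := exists_add_of_le hb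
        refine ⟨c, ⟨?_, ?_⟩, add_comm _ _⟩
        · intro f' hf'
          obtain ⟨f, hf, rfl⟩ := List.mem_map.mp hf'
          rw [tsub_le_iff_left]
          exact h1 f hf
        · simp only [Pi.add_apply, Finset.sum_add_distrib] at h2
          omega
      · rintro ⟨c, ⟨h1, h2⟩, rfl⟩
        refine ⟨le_add_self, fun f hf => ?_, ?_⟩
        · have := h1 (f - b) (List.mem_map.mpr ⟨f, hf, rfl⟩)
          rwa [tsub_le_iff_right] at this
        · simp only [Pi.add_apply, Finset.sum_add_distrib]
          omega
    rw [← Set.ncard_image_of_injective {a | (∀ f ∈ l.map (· - b), ¬ f ≤ a) ∧ _}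
      (add_left_injective b), ← himg,
      ← Set.ncard_union_eq ?_ ((finite_setOf_sum_lt d n).subset fun a ha => ha.2)
      ((finite_setOf_sum_lt d n).subset fun a ha => ha.2.2)]
    · congr 1
      ext a
      simp only [List.mem_cons, Set.mem_union, Set.mem_ofPred_eq, forall_eq_or_imp]
      tauto
    · rw [Set.disjoint_left]
      rintro a ⟨h, -⟩ ⟨h', -⟩
      exact h b (by simp) h'

open Classical in
-- By Dickson's lemma the complement of `D` has finitely many minimal elements, which generate it as
-- a monomial ideal. There are none exactly when `D` is everything.
theorem exists_polynomial_isLowerSet {d : ℕ} {D : Set (Fin d → ℕ)} (hD : IsLowerSet D) :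
    ∃ p : ℚ[X], p.natDegree ≤ d ∧
      p.coeff d = (if D = Set.univ then (d ! : ℚ)⁻¹ else 0) ∧
      ∀ᶠ n : ℕ in atTop, ({a : Fin d → ℕ | a ∈ D ∧ ∑ i, a i < n}.ncard : ℚ) = p.eval (n : ℚ) := by
  have hfin : {a | Minimal (· ∉ D) a}.Finite :=
    WellQuasiOrderedLE.finite_of_isAntichain (setOfPred_minimal_antichain _)
  obtain ⟨p, h1, h2, h3⟩ := exists_polynomial_list d _ hfin.toFinset.toList rfl
  have hmem : ∀ a, a ∈ D ↔ ∀ f ∈ hfin.toFinset.toList, ¬ f ≤ a := by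
    intro a
    simp only [Finset.mem_toList, Set.Finite.mem_toFinset, Set.mem_ofPred_eq]
    refine ⟨fun ha f hf hfa => hf.1 (hD hfa ha), fun h => ?_⟩
    by_contra ha
    obtain ⟨f, hfa, hf⟩ := exists_minimal_le_of_wellFoundedLT (· ∉ D) a ha
    exact h f hf hfa
  have huniv : hfin.toFinset.toList.length = 0 ↔ D = Set.univ := by
    rw [List.length_eq_zero_iff]
    refine ⟨fun h => Set.eq_univ_of_forall fun a => (hmem a).mpr (by simp [h]), fun h => ?_⟩
    rw [List.eq_nil_iff_forall_not_mem]
    intro a ha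
    exact (hmem a).mp (h ▸ Set.mem_univ a) a ha le_rfl
  refine ⟨p, h1, by simpa only [huniv] using h2, ?_⟩
  filter_upwards [h3] with n hn
  simpa only [← hmem] using hn

theorem setOf_weight_lt_subset {d : ℕ} {s : Fin d → ℝ} (hs : ∀ i, 1 ≤ s i) (n : ℕ) :
    {a : Fin d → ℕ | ∑ i, a i * s i < n} ⊆ {a : Fin d → ℕ | ∑ i, a i < n} := by
  intro a ha
  have h : ∑ i, (a i : ℝ) ≤ ∑ i, a i * s i :=
    Finset.sum_le_sum fun i _ => le_mul_of_one_le_right (Nat.cast_nonneg _) (hs i)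
  have := h.trans_lt ha
  exact_mod_cast this

/-- Discrete form of integrating `(d + 1) u^d` over an interval of length `s`; it makes the slices
of a simplex telescope. -/
theorem pow_succ_sub_pow_succ_ge {u s : ℝ} (hu : 0 ≤ u) (hs : 0 ≤ s) (d : ℕ) :
    (d + 1) * s * u ^ d ≤ (u + s) ^ (d + 1) - u ^ (d + 1) := by
  induction d with
  | zero => simp
  | succ d ih =>
    have h1 : (d + 1) * s * u ^ (d + 1) ≤ ((u + s) ^ (d + 1) - u ^ (d + 1)) * u := by
      calc _ = ((d + 1) * s * u ^ d) * u := by ring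
        _ ≤ _ := by gcongr
    have h2 : s * u ^ (d + 1) ≤ s * (u + s) ^ (d + 1) := by
      gcongr; linarith
    push_cast
    calc _ = (d + 1) * s * u ^ (d + 1) + s * u ^ (d + 1) := by ring
      _ ≤ ((u + s) ^ (d + 1) - u ^ (d + 1)) * u + s * (u + s) ^ (d + 1) := by gcongr
      _ = _ := by ring

/-- The number of lattice points in a simplex is at most the volume of a slightly larger one. -/
theorem ncard_weight_lt_le (d : ℕ) : ∀ (s : Fin d → ℝ), (∀ i, 0 < s i) → ∀ x : ℝ, 0 ≤ x →
    {a : Fin d → ℕ | ∑ i, a i * s i < x}.Finite ∧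
    ({a : Fin d → ℕ | ∑ i, a i * s i < x}.ncard : ℝ) ≤ (x + ∑ i, s i) ^ d / (d ! * ∏ i, s i) := by
  induction d with
  | zero =>
    intro s _ x _
    refine ⟨Set.toFinite _, ?_⟩
    have : ({a : Fin 0 → ℕ | ∑ i, a i * s i < x}.ncard : ℝ) ≤ 1 := by
      exact_mod_cast (Set.ncard_le_one_of_subsingleton _)
    simpa using this
  | succ d ih =>
    intro s hs x hx
    set s' : Fin d → ℝ := fun i => s i.succ
    have hs' : ∀ i, 0 < s' i := fun i => hs _
    -- The indices `j < M` are exactly those with `j * s 0 < x`, i.e. the nonempty slices.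
    set M := ⌈x / s 0⌉₊ with hM
    have h0 := hs 0
    have hlt : ∀ j ∈ Finset.range M, 0 ≤ x - j * s 0 := by
      intro j hj
      rw [Finset.mem_range, hM, Nat.lt_ceil, lt_div_iff₀ h0] at hj
      linarith
    have hcover : {a : Fin (d + 1) → ℕ | ∑ i, a i * s i < x} ⊆
        ⋃ j ∈ Finset.range M, (Fin.cons (n := d) (α := fun _ => ℕ) j) ''
          {a : Fin d → ℕ | ∑ i, a i * s' i < x - j * s 0} := by
      intro a ha
      have ha' : ∑ i, a i * s i < x := ha
      rw [Fin.sum_univ_succ] at ha'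
      have hnn : 0 ≤ ∑ i : Fin d, a i.succ * s i.succ :=
        Finset.sum_nonneg fun i _ => mul_nonneg (Nat.cast_nonneg _) (hs _).le
      simp only [Set.mem_iUnion]
      refine ⟨a 0, ?_, Fin.tail a, ?_, Fin.cons_self_tail a⟩
      · rw [Finset.mem_range, hM, Nat.lt_ceil, lt_div_iff₀ h0]
        linarith
      · show ∑ i, (Fin.tail a i : ℝ) * s' i < _
        simp only [Fin.tail, s']
        linarith
    have hfin : ∀ j ∈ Finset.range M, ((Fin.cons (n := d) (α := fun _ => ℕ) j) ''
          {a : Fin d → ℕ | ∑ i, a i * s' i < x - j * s 0}).Finite := fun j hj =>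
      (ih s' hs' _ (hlt j hj)).1.image _
    refine ⟨(Set.Finite.biUnion (Finset.finite_toSet _) hfin).subset hcover, ?_⟩
    have hcard : {a : Fin (d + 1) → ℕ | ∑ i, a i * s i < x}.ncard ≤
        ∑ j ∈ Finset.range M, {a : Fin d → ℕ | ∑ i, a i * s' i < x - j * s 0}.ncard := by
      refine (Set.ncard_le_ncard hcover (Set.Finite.biUnion (Finset.finite_toSet _) hfin)).trans
        ((Finset.set_ncard_biUnion_le _ _).trans (Finset.sum_le_sum fun j _ => ?_))
      rw [Set.ncard_image_of_injective _ (Fin.cons_right_injective _)]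
    set S := ∑ i, s' i with hS
    have hSnn : 0 ≤ S := Finset.sum_nonneg fun i _ => (hs' i).le
    set P := ∏ i, s' i with hP
    have hPpos : 0 < P := Finset.prod_pos fun i _ => hs' i
    -- Up to a constant, the slice at height `j` has at most `v j - v (j + 1)` points. The extra `s
    -- 0` makes this difference start at the inductive bound for the slice and keeps `v M`
    -- nonnegative.
    set v : ℕ → ℝ := fun j => (x + s 0 + S - j * s 0) ^ (d + 1) with hv
    have hterm : ∀ j ∈ Finset.range M,
        ({a : Fin d → ℕ | ∑ i, a i * s' i < x - j * s 0}.ncard : ℝ) ≤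
          (v j - v (j + 1)) / ((d + 1)! * (s 0 * P)) := by
      intro j hj
      refine (ih s' hs' _ (hlt j hj)).2.trans ?_
      have := pow_succ_sub_pow_succ_ge (add_nonneg (hlt j hj) hSnn) h0.le d
      have h2 : v j - v (j + 1) =
          (x - j * s 0 + S + s 0) ^ (d + 1) - (x - j * s 0 + S) ^ (d + 1) := by
        simp only [hv]
        push_cast
        ring
      rw [h2, div_le_div_iff₀ (by positivity) (by positivity), Nat.factorial_succ]
      push_cast
      calc (x - j * s 0 + S) ^ d * ((d + 1) * d ! * (s 0 * P))
          = ((d + 1) * s 0 * (x - j * s 0 + S) ^ d) * (d ! * P) := by ring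
        _ ≤ _ := by gcongr
    have hvM : 0 ≤ v M := by
      have : (M : ℝ) < x / s 0 + 1 := Nat.ceil_lt_add_one (by positivity)
      have h3 : (M : ℝ) * s 0 ≤ x + s 0 := by
        have := mul_le_mul_of_nonneg_right this.le h0.le
        rwa [add_mul, div_mul_cancel₀ _ h0.ne', one_mul] at this
      exact pow_nonneg (by linarith) _
    calc ({a : Fin (d + 1) → ℕ | ∑ i, a i * s i < x}.ncard : ℝ)
        ≤ ∑ j ∈ Finset.range M, ({a : Fin d → ℕ | ∑ i, a i * s' i < x - j * s 0}.ncard : ℝ) := by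
          exact_mod_cast hcard
      _ ≤ ∑ j ∈ Finset.range M, (v j - v (j + 1)) / ((d + 1)! * (s 0 * P)) :=
          Finset.sum_le_sum hterm
      _ = (v 0 - v M) / ((d + 1)! * (s 0 * P)) := by
          rw [← Finset.sum_div, Finset.sum_range_sub']
      _ ≤ v 0 / ((d + 1)! * (s 0 * P)) := by gcongr; linarith
      _ = _ := by
          rw [Fin.sum_univ_succ, Fin.prod_univ_succ]
          simp only [hv]
          norm_num [add_assoc]
          rfl

theorem tendsto_eval_div_pow {p : ℚ[X]} {d : ℕ} (hp : p.natDegree ≤ d) :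
    Tendsto (fun n : ℕ => ((p.eval (n : ℚ) : ℚ) : ℝ) / (n : ℝ) ^ d) atTop
      (𝓝 ((p.coeff d : ℚ) : ℝ)) := by
  have h : ∀ n : ℕ, 1 ≤ n → ∑ i ∈ Finset.range (d + 1), (p.coeff i : ℝ) * ((n : ℝ)⁻¹) ^ (d - i) =
      ((p.eval (n : ℚ) : ℚ) : ℝ) / (n : ℝ) ^ d := by
    intro n hn
    have hn' : (n : ℝ) ≠ 0 := by positivity
    rw [eval_eq_sum_range' (Nat.lt_succ_of_le hp)]
    push_cast
    rw [Finset.sum_div]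
    refine Finset.sum_congr rfl fun i hi => ?_
    rw [mul_div_assoc, inv_pow]
    congr 1
    rw [eq_div_iff (pow_ne_zero _ hn'), inv_mul_eq_div, div_eq_iff (pow_ne_zero _ hn'), ← pow_add]
    congr 1
    have := Finset.mem_range.mp hi
    omega
  refine Tendsto.congr' ((eventually_ge_atTop 1).mono h) ?_
  have hinv : Tendsto (fun n : ℕ => ((n : ℝ)⁻¹)) atTop (𝓝 0) :=
    tendsto_inv_atTop_nhds_zero_nat
  have : Tendsto (fun n : ℕ =>
      ∑ i ∈ Finset.range (d + 1), (p.coeff i : ℝ) * ((n : ℝ)⁻¹) ^ (d - i)) atTop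
      (𝓝 (∑ i ∈ Finset.range (d + 1), (p.coeff i : ℝ) * 0 ^ (d - i))) :=
    tendsto_finsetSum _ fun i _ => (hinv.pow _).const_mul _
  convert this using 2
  rw [Finset.sum_eq_single d]
  · simp
  · intro i hi hid
    have := Finset.mem_range.mp hi
    rw [zero_pow (by omega), mul_zero]
  · simp

end Counting

/-! ### Standard elements `y^a g_j` and their count. -/

section StandardMonomials

variable {R : Type*} [CommRing R] {r t : ℕ}

/-- The monomial `y^a`. -/
def monomialAt (y : Fin r → R) (a : Fin r → ℕ) : R := ∏ i, y i ^ a i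

theorem monomialAt_add (y : Fin r → R) (a b : Fin r → ℕ) :
    monomialAt y (a + b) = monomialAt y a * monomialAt y b := by
  simp [monomialAt, pow_add, Finset.prod_mul_distrib]

theorem monomialAt_mem_pow {I : Ideal R} {y : Fin r → R} (hy : ∀ i, y i ∈ I) (a : Fin r → ℕ) :
    monomialAt y a ∈ I ^ ∑ i, a i := by
  rw [monomialAt, ← Finset.prod_pow_eq_pow_sum]
  exact Ideal.prod_mem_prod fun i _ => Ideal.pow_mem_pow (hy i) _

/-- Pairs of an index `j` and an exponent `a`, ordered lexicographically. -/
abbrev MonoIdx (r t : ℕ) := Fin t ×ₗ Lex (Fin r → ℕ)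

/-- The pair `(j, a)`. -/
def monoIdx (j : Fin t) (a : Fin r → ℕ) : MonoIdx r t := toLex (j, toLex a)

/-- The element `y^a g_j`. -/
def MonoIdx.elt (y : Fin r → R) (g : Fin t → R) (p : MonoIdx r t) : R :=
  monomialAt y (ofLex (ofLex p).2) * g (ofLex p).1

/-- The degree `|a| + δ_j`. -/
def MonoIdx.deg (δ : Fin t → ℕ) (p : MonoIdx r t) : ℕ :=
  ∑ i, (ofLex (ofLex p).2) i + δ (ofLex p).1

theorem elt_monoIdx (y : Fin r → R) (g : Fin t → R) (j : Fin t) (a : Fin r → ℕ) :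
    (monoIdx j a).elt y g = monomialAt y a * g j := rfl

theorem deg_monoIdx (δ : Fin t → ℕ) (j : Fin t) (a : Fin r → ℕ) :
    (monoIdx j a).deg δ = ∑ i, a i + δ j := rfl

theorem monoIdx_cases (p : MonoIdx r t) : ∃ j a, p = monoIdx j a := ⟨_, _, rfl⟩

theorem monoIdx_add_lt {i j : Fin t} {a b : Fin r → ℕ} (h : monoIdx i a < monoIdx j b)
    (c : Fin r → ℕ) : monoIdx i (a + c) < monoIdx j (b + c) := by
  rw [monoIdx, monoIdx, Prod.Lex.toLex_lt_toLex] at h ⊢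
  refine h.imp id fun h => ⟨h.1, ?_⟩
  exact add_lt_add_left h.2 (toLex c)

theorem MonoIdx.finite_deg_lt (δ : Fin t → ℕ) (n : ℕ) : {p : MonoIdx r t | p.deg δ < n}.Finite := by
  refine (Set.Finite.subset ((Set.finite_univ (α := Fin t)).prod (finite_setOf_sum_lt r n) |>.image
    fun q => monoIdx q.1 q.2)) fun p hp => ?_
  obtain ⟨j, a, rfl⟩ := monoIdx_cases p
  refine ⟨(j, a), ⟨Set.mem_univ _, ?_⟩, rfl⟩
  have : (monoIdx j a).deg δ < n := hp
  rw [deg_monoIdx] at this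
  show ∑ i, a i < n
  omega

theorem MonoIdx.finite_deg_eq (δ : Fin t → ℕ) (n : ℕ) : {p : MonoIdx r t | p.deg δ = n}.Finite :=
  (MonoIdx.finite_deg_lt δ (n + 1)).subset fun p hp =>
    Nat.lt_succ_of_le (show p.deg δ = n from hp).le

theorem ncard_monoIdx {T : Set (MonoIdx r t)} (hT : T.Finite) :
    T.ncard = ∑ j, {a | monoIdx j a ∈ T}.ncard := by
  have e : T ≃ Σ j : Fin t, {a : Fin r → ℕ | monoIdx j a ∈ T} :=
    { toFun := fun p => ⟨(ofLex p.1).1, ofLex (ofLex p.1).2, p.2⟩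
      invFun := fun q => ⟨monoIdx q.1 q.2.1, q.2.2⟩
      left_inv := fun _ => rfl
      right_inv := fun _ => rfl }
  have : ∀ j, Finite {a : Fin r → ℕ | monoIdx j a ∈ T} := fun j =>
    Set.Finite.preimage (f := fun a => monoIdx j a) (fun a _ b _ h => by
      simpa [monoIdx] using h) hT
  rw [← Nat.card_coe_set_eq, Nat.card_congr e, Nat.card_sigma]
  rfl

variable [IsLocalRing R]

/-- The elements `y^a g_j` of degree `n` generate `m_R^n`, for all `n`. -/
structure GeneratesPowers (y : Fin r → R) (g : Fin t → R) (δ : Fin t → ℕ) : Prop where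
  mem : ∀ i, y i ∈ maximalIdeal R
  span_eq : ∀ n, Ideal.span (MonoIdx.elt y g '' {p | p.deg δ = n}) = maximalIdeal R ^ n

/-- `y^a g_j` is standard if, modulo higher degree, it does not lie in the span of the earlier
elements of the same degree. -/
def MonoIdx.IsStd (y : Fin r → R) (g : Fin t → R) (δ : Fin t → ℕ) (p : MonoIdx r t) : Prop :=
  p.elt y g ∉ maximalIdeal R ^ (p.deg δ + 1) ⊔
    Ideal.span (MonoIdx.elt y g '' {q | q.deg δ = p.deg δ ∧ q < p})

variable {y : Fin r → R} {g : Fin t → R} {δ : Fin t → ℕ}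

theorem GeneratesPowers.elt_mem (h : GeneratesPowers y g δ) (p : MonoIdx r t) :
    p.elt y g ∈ maximalIdeal R ^ p.deg δ := by
  rw [← h.span_eq]
  exact Ideal.subset_span ⟨p, rfl, rfl⟩

/-- A relation expressing `y^a g_j` through earlier elements and higher order terms stays one after
multiplication by `y^c`, since the order on indices is translation invariant. -/
theorem GeneratesPowers.isLowerSet (h : GeneratesPowers y g δ) (j : Fin t) :
    IsLowerSet {a | (monoIdx j a).IsStd y g δ} := by
  intro b a hab hb ha
  obtain ⟨c, rfl⟩ := exists_add_of_le hab
  refine hb ?_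
  have key : maximalIdeal R ^ ((monoIdx j a).deg δ + 1) ⊔
      Ideal.span (MonoIdx.elt y g '' {q | q.deg δ = (monoIdx j a).deg δ ∧ q < monoIdx j a}) ≤
      Submodule.comap (LinearMap.mulLeft R (monomialAt y c))
        (maximalIdeal R ^ ((monoIdx j (a + c)).deg δ + 1) ⊔
          Ideal.span (MonoIdx.elt y g ''
            {q | q.deg δ = (monoIdx j (a + c)).deg δ ∧ q < monoIdx j (a + c)})) := by
    have hdeg : (monoIdx j (a + c)).deg δ = ∑ i, c i + (monoIdx j a).deg δ := by
      simp only [deg_monoIdx, Pi.add_apply, Finset.sum_add_distrib]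
      ring
    refine sup_le ?_ (Ideal.span_le.mpr ?_)
    · intro z hz
      refine Ideal.mem_sup_left ?_
      rw [hdeg, add_assoc, pow_add]
      exact Ideal.mul_mem_mul (monomialAt_mem_pow h.mem c) hz
    · rintro _ ⟨q, ⟨hq1, hq2⟩, rfl⟩
      obtain ⟨i, b, rfl⟩ := monoIdx_cases q
      refine Ideal.mem_sup_right (Ideal.subset_span ⟨monoIdx i (b + c), ⟨?_, ?_⟩, ?_⟩)
      · rw [hdeg, ← hq1]
        simp only [deg_monoIdx, Pi.add_apply, Finset.sum_add_distrib]
        ring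
      · exact monoIdx_add_lt hq2 c
      · rw [LinearMap.mulLeft_apply, elt_monoIdx, elt_monoIdx, monomialAt_add]
        ring
  have := key ha
  rwa [Submodule.mem_comap, LinearMap.mulLeft_apply, elt_monoIdx, ← mul_assoc, mul_comm (monomialAt y c),
    ← monomialAt_add] at this

open Classical in
-- Adjoining the elements of degree `n` to `m^(n+1) + J` gives `m^n + J`, and `m` multiplies each of
-- them into `m^(n+1)`. The case `J = 0` counts standard elements; the general case bounds `ℓ(R/J)`.
theorem GeneratesPowers.length_succ (h : GeneratesPowers y g δ) (J : Ideal R) (n : ℕ) :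
    Module.length R (R ⧸ (maximalIdeal R ^ (n + 1) ⊔ J)) =
      ({p : MonoIdx r t | p.deg δ = n ∧ p.elt y g ∉ maximalIdeal R ^ (n + 1) ⊔ J ⊔
        Ideal.span (MonoIdx.elt y g '' {q | q.deg δ = n ∧ q < p})}.ncard : ℕ∞) +
      Module.length R (R ⧸ (maximalIdeal R ^ n ⊔ J)) := by
  have hfin := MonoIdx.finite_deg_eq (r := r) δ n
  rw [length_quotient_eq_card_add (maximalIdeal R ^ (n + 1) ⊔ J) (MonoIdx.elt y g) hfin.toFinset]
  · congr 1
    · rw [← Set.ncard_coe_finset]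
      congr 2
      ext p
      simp
    · apply length_quotient_congr
      rw [Set.Finite.coe_toFinset, h.span_eq, sup_right_comm,
        sup_eq_right.mpr (Ideal.pow_le_pow_right n.le_succ : maximalIdeal R ^ (n + 1) ≤ _)]
  · intro p hp c hc
    have hp' : p.deg δ = n := by simpa using hp
    refine Ideal.mem_sup_left ?_
    rw [pow_succ', ← hp']
    exact Ideal.mul_mem_mul hc (h.elt_mem p)

/-- The Hilbert-Samuel function counts standard elements. -/
theorem GeneratesPowers.length_pow (h : GeneratesPowers y g δ) (n : ℕ) :
    Module.length R (R ⧸ maximalIdeal R ^ n) =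
      ({p : MonoIdx r t | p.IsStd y g δ ∧ p.deg δ < n}.ncard : ℕ∞) := by
  induction n with
  | zero =>
    rw [length_quotient_congr (show maximalIdeal R ^ 0 = ⊤ by simp),
      Module.length_eq_zero_iff.mpr inferInstance]
    simp
  | succ n ih =>
    have := h.length_succ ⊥ n
    rw [length_quotient_congr (sup_bot_eq _), length_quotient_congr (sup_bot_eq _)] at this
    simp only [sup_bot_eq] at this
    rw [this, ih, ← Nat.cast_add, ← Set.ncard_union_eq ?_
      ((MonoIdx.finite_deg_eq δ n).subset fun p hp => hp.1)
      ((MonoIdx.finite_deg_lt δ n).subset fun p hp => hp.2)]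
    · congr 2
      ext p
      simp only [MonoIdx.IsStd, Set.mem_union, Set.mem_ofPred_eq, Nat.lt_succ_iff_lt_or_eq]
      constructor
      · rintro (⟨rfl, h⟩ | ⟨h, h'⟩)
        · exact ⟨h, Or.inr rfl⟩
        · exact ⟨h, Or.inl h'⟩
      · rintro ⟨h, h' | rfl⟩
        · exact Or.inr ⟨h, h'⟩
        · exact Or.inl ⟨rfl, h⟩
    · rw [Set.disjoint_left]
      rintro p ⟨h, -⟩ ⟨-, h'⟩
      omega

/-- Standard elements outside `J` bound the length of `R/J`. -/
theorem GeneratesPowers.length_le (h : GeneratesPowers y g δ) {J : Ideal R} {n : ℕ}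
    (hJ : maximalIdeal R ^ n ≤ J) :
    Module.length R (R ⧸ J) ≤
      ({p : MonoIdx r t | p.IsStd y g δ ∧ p.elt y g ∉ J ∧ p.deg δ < n}.ncard : ℕ∞) := by
  suffices H : ∀ n, Module.length R (R ⧸ (maximalIdeal R ^ n ⊔ J)) ≤
      ({p : MonoIdx r t | p.IsStd y g δ ∧ p.elt y g ∉ J ∧ p.deg δ < n}.ncard : ℕ∞) by
    rw [length_quotient_congr (sup_eq_right.mpr hJ).symm]
    exact H n
  clear hJ n
  intro n
  induction n with
  | zero =>
    rw [length_quotient_congr (show maximalIdeal R ^ 0 ⊔ J = ⊤ by simp),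
      Module.length_eq_zero_iff.mpr inferInstance]
    exact zero_le
  | succ n ih =>
    rw [h.length_succ J n]
    refine (add_le_add_right ih _).trans ?_
    rw [← Nat.cast_add, ← Set.ncard_union_eq ?_
      ((MonoIdx.finite_deg_eq δ n).subset fun p hp => hp.1)
      ((MonoIdx.finite_deg_lt δ n).subset fun p hp => hp.2.2)]
    · norm_cast
      refine Set.ncard_le_ncard ?_ ((MonoIdx.finite_deg_lt δ (n + 1)).subset fun p hp => hp.2.2)
      rintro p (⟨rfl, hp⟩ | ⟨h1, h2, h3⟩)
      -- An element that is new modulo `m^(n+1) + J` and its predecessors is also new without `J`,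
      -- hence standard, and it is not in `J`.
      · refine ⟨fun h => hp ?_, fun h => hp ?_, Nat.lt_succ_self _⟩
        · exact (sup_le_sup_right le_sup_left _ :
            maximalIdeal R ^ (p.deg δ + 1) ⊔ _ ≤ maximalIdeal R ^ (p.deg δ + 1) ⊔ J ⊔ _) h
        · exact Ideal.mem_sup_left (Ideal.mem_sup_right h)
      · exact ⟨h1, h2, h3.trans (Nat.lt_succ_self _)⟩
    · rw [Set.disjoint_left]
      rintro p ⟨h, -⟩ ⟨-, -, h'⟩
      omega

end StandardMonomials

/-! ### Reductions of the maximal ideal and analytic independence. -/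

section Reductions

variable {R : Type*} [CommRing R] {r t : ℕ}

theorem monomialAt_mul_const (l : Fin r → R) (w : R) (a : Fin r → ℕ) :
    monomialAt (fun i => l i * w) a = monomialAt l a * w ^ ∑ i, a i := by
  simp [monomialAt, mul_pow, Finset.prod_mul_distrib, Finset.prod_pow_eq_pow_sum]

theorem span_range_pow_le (y : Fin r → R) (k : ℕ) :
    Ideal.span (Set.range y) ^ k ≤ Ideal.span (monomialAt y '' {a | ∑ i, a i = k}) := by
  induction k with
  | zero =>
    rw [pow_zero, Ideal.one_eq_top, top_le_iff, Ideal.eq_top_iff_one]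
    exact Ideal.subset_span ⟨0, by simp, by simp [monomialAt]⟩
  | succ k ih =>
    rw [pow_succ]
    refine (Ideal.mul_mono_left ih).trans ?_
    rw [Ideal.span_mul_span', Ideal.span_le]
    rintro _ ⟨_, ⟨a, ha, rfl⟩, _, ⟨i, rfl⟩, rfl⟩
    refine Ideal.subset_span ⟨a + Pi.single i 1, ?_, ?_⟩
    · have : ∑ i, a i = k := ha
      simp [Finset.sum_add_distrib, this]
    · rw [monomialAt_add]
      congr 1
      simp [monomialAt, Pi.single_apply, pow_ite, Finset.prod_ite_eq']

/-- For `Q = (y)`, the module `Q^n/Q^(n+1)` is generated by the monomials of degree `n`, and each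
generates a quotient of `R/Q`. -/
theorem length_quotient_span_pow_le (y : Fin r → R) (n : ℕ) :
    Module.length R (R ⧸ Ideal.span (Set.range y) ^ n) ≤
      ({a : Fin r → ℕ | ∑ i, a i < n}.ncard : ℕ∞) *
        Module.length R (R ⧸ Ideal.span (Set.range y)) := by
  classical
  set Q := Ideal.span (Set.range y)
  have hy : ∀ i, y i ∈ Q := fun i => Ideal.subset_span ⟨i, rfl⟩
  induction n with
  | zero =>
    rw [length_quotient_congr (show Q ^ 0 = ⊤ by simp), Module.length_eq_zero_iff.mpr inferInstance]
    exact zero_le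
  | succ n ih =>
    have hfin : {a : Fin r → ℕ | ∑ i, a i = n}.Finite :=
      (finite_setOf_sum_lt r (n + 1)).subset fun a ha =>
        Nat.lt_succ_of_le (show ∑ i, a i = n from ha).le
    have h1 := length_quotient_le_card_mul_add (Q ^ (n + 1)) Q (monomialAt y) hfin.toFinset
      (fun a ha c hc => by
        have ha' : ∑ i, a i = n := by simpa using ha
        rw [pow_succ', ← ha']
        exact Ideal.mul_mem_mul hc (monomialAt_mem_pow hy a))
    have h2 : Module.length R
        (R ⧸ (Q ^ (n + 1) ⊔ Ideal.span (monomialAt y '' (hfin.toFinset : Set (Fin r → ℕ))))) ≤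
        Module.length R (R ⧸ Q ^ n) := by
      refine length_quotient_anti (le_sup_of_le_right ?_)
      rw [Set.Finite.coe_toFinset]
      exact span_range_pow_le y n
    refine h1.trans ((add_le_add_right (h2.trans ih) _).trans (le_of_eq ?_))
    rw [← add_mul, ← Set.ncard_eq_toFinset_card _ hfin, ← Nat.cast_add, ← Set.ncard_union_eq ?_ hfin
      (finite_setOf_sum_lt r n)]
    · congr 3
      ext a
      simp only [Set.mem_union, Set.mem_ofPred_eq]
      omega
    · rw [Set.disjoint_left]
      intro a h h'
      have h1 : ∑ i, a i = n := h
      have h2 : ∑ i, a i < n := h'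
      omega

variable [IsLocalRing R]

/-- `Q` is a reduction of the maximal ideal. -/
def IsReduction (Q : Ideal R) : Prop :=
  Q ≤ maximalIdeal R ∧ ∃ n, maximalIdeal R ^ (n + 1) ≤ Q * maximalIdeal R ^ n

/-- Nakayama's lemma for `m^(n+1)`: being a reduction can be checked modulo `m^(n+2)`. -/
theorem isReduction_of_le_sup [IsNoetherianRing R] {Q : Ideal R} (hQ : Q ≤ maximalIdeal R) {n : ℕ}
    (h : maximalIdeal R ^ (n + 1) ≤ Q * maximalIdeal R ^ n ⊔ maximalIdeal R ^ (n + 2)) :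
    IsReduction Q := by
  refine ⟨hQ, n, Submodule.le_of_le_smul_of_le_jacobson_bot (I := maximalIdeal R)
    (IsNoetherian.noetherian _) (maximalIdeal_le_jacobson _) ?_⟩
  rwa [smul_eq_mul, ← pow_succ']

theorem pow_add_le_of_reduction {Q : Ideal R} {n : ℕ}
    (h : maximalIdeal R ^ (n + 1) ≤ Q * maximalIdeal R ^ n) (c : ℕ) :
    maximalIdeal R ^ (n + c) ≤ Q ^ c * maximalIdeal R ^ n := by
  induction c with
  | zero => simp
  | succ c ih =>
    calc maximalIdeal R ^ (n + (c + 1)) = maximalIdeal R ^ (n + c) * maximalIdeal R := by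
          rw [← add_assoc, pow_succ]
      _ ≤ Q ^ c * maximalIdeal R ^ n * maximalIdeal R := Ideal.mul_mono_left ih
      _ = Q ^ c * maximalIdeal R ^ (n + 1) := by rw [mul_assoc, ← pow_succ]
      _ ≤ Q ^ c * (Q * maximalIdeal R ^ n) := Ideal.mul_mono_right h
      _ = _ := by rw [← mul_assoc, ← pow_succ]

/-- `u` and `v` have order `n` and `u - v` is, after multiplication by the maximal ideal, in
`Q m^n`. -/
def CongrModReduction (Q : Ideal R) (n : ℕ) (u v : R) : Prop :=
  u ∈ maximalIdeal R ^ n ∧ v ∈ maximalIdeal R ^ n ∧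
    ∀ z ∈ maximalIdeal R, z * (u - v) ∈ Q * maximalIdeal R ^ n

theorem CongrModReduction.one (Q : Ideal R) : CongrModReduction Q 0 1 1 := by
  refine ⟨by simp, by simp, fun z _ => by simp⟩

theorem CongrModReduction.mul {Q : Ideal R} {n n' : ℕ} {u v u' v' : R}
    (h : CongrModReduction Q n u v) (h' : CongrModReduction Q n' u' v') :
    CongrModReduction Q (n + n') (u * u') (v * v') := by
  refine ⟨?_, ?_, fun z hz => ?_⟩
  · rw [pow_add]; exact Ideal.mul_mem_mul h.1 h'.1
  · rw [pow_add]; exact Ideal.mul_mem_mul h.2.1 h'.2.1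
  · rw [show z * (u * u' - v * v') = z * (u - v) * u' + v * (z * (u' - v')) by ring]
    refine Ideal.add_mem _ ?_ ?_
    · rw [pow_add, ← mul_assoc]
      exact Ideal.mul_mem_mul (h.2.2 z hz) h'.1
    · rw [pow_add, mul_left_comm]
      exact Ideal.mul_mem_mul h.2.1 (h'.2.2 z hz)

theorem CongrModReduction.pow {Q : Ideal R} {n : ℕ} {u v : R}
    (h : CongrModReduction Q n u v) (k : ℕ) : CongrModReduction Q (k * n) (u ^ k) (v ^ k) := by
  induction k with
  | zero => simpa using CongrModReduction.one Q
  | succ k ih => simpa [pow_succ, add_mul] using ih.mul h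

theorem CongrModReduction.prod {Q : Ideal R} {ι : Type*} (s : Finset ι) {n : ι → ℕ} {u v : ι → R}
    (h : ∀ i ∈ s, CongrModReduction Q (n i) (u i) (v i)) :
    CongrModReduction Q (∑ i ∈ s, n i) (∏ i ∈ s, u i) (∏ i ∈ s, v i) := by
  classical
  induction s using Finset.induction_on with
  | empty => simpa using CongrModReduction.one Q
  | insert a s ha ih =>
    rw [Finset.sum_insert ha, Finset.prod_insert ha, Finset.prod_insert ha]
    exact (h a (Finset.mem_insert_self _ _)).mul (ih fun i hi => h i (Finset.mem_insert_of_mem hi))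

/-- For degree `n ≥ 1` the two monomials already differ by an element of `Q m^(n-1)`. The extra
factor from `m` in `CongrModReduction` turns this into `Q m^n`, which also makes sense for `n = 0`.
-/
theorem congrModReduction_monomialAt {Q : Ideal R} {y x : Fin r → R}
    (hy : ∀ i, y i ∈ maximalIdeal R) (hx : ∀ i, x i ∈ maximalIdeal R) (h : ∀ i, y i - x i ∈ Q)
    (a : Fin r → ℕ) :
    CongrModReduction Q (∑ i, a i) (monomialAt y a) (monomialAt x a) := by
  refine CongrModReduction.prod _ fun i _ => ?_
  have : CongrModReduction Q 1 (y i) (x i) := by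
    refine ⟨by simpa using hy i, by simpa using hx i, fun z hz => ?_⟩
    rw [pow_one, mul_comm Q]
    exact Ideal.mul_mem_mul hz (h i)
  simpa using this.pow (a i)

/-- A nonzero polynomial over the infinite residue field has a point where it does not vanish; lift
that point to `R`. -/
theorem exists_isUnit_eval [Infinite (ResidueField R)] {T : Finset (Fin r → ℕ)}
    {u : (Fin r → ℕ) → R} {a : Fin r → ℕ} (ha : a ∈ T) (hu : IsUnit (u a)) :
    ∃ l : Fin r → R, IsUnit (∑ b ∈ T, u b * monomialAt l b) := by
  classical
  set F : MvPolynomial (Fin r) (ResidueField R) :=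
    ∑ b ∈ T, MvPolynomial.monomial (Finsupp.equivFunOnFinite.symm b) (residue R (u b)) with hF
  have hF0 : F ≠ 0 := by
    intro h0
    have : MvPolynomial.coeff (Finsupp.equivFunOnFinite.symm a) F = residue R (u a) := by
      rw [hF, MvPolynomial.coeff_sum, Finset.sum_eq_single a]
      · simp
      · intro b _ hb
        rw [MvPolynomial.coeff_monomial, if_neg]
        simpa using hb
      · exact fun h => absurd ha h
    rw [h0, MvPolynomial.coeff_zero] at this
    exact (hu.map (residue R)).ne_zero this.symm
  obtain ⟨x, hx⟩ : ∃ x, MvPolynomial.eval x F ≠ 0 := by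
    by_contra! h
    exact hF0 (MvPolynomial.funext fun x => by rw [h x, map_zero])
  choose l hl using fun i => residue_surjective (x i)
  refine ⟨l, ?_⟩
  by_contra hn
  refine hx ?_
  have h1 : residue R (∑ b ∈ T, u b * monomialAt l b) = 0 :=
    (residue_eq_zero_iff _).mpr ((mem_maximalIdeal _).mpr hn)
  rw [← h1, hF, map_sum, map_sum]
  refine Finset.sum_congr rfl fun b _ => ?_
  rw [MvPolynomial.eval_monomial, map_mul, monomialAt, map_prod,
    Finsupp.prod_fintype _ _ (by simp)]
  simp [hl]

/-- A form with a unit coefficient vanishing to higher order on the generators of a reduction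
yields a reduction with fewer generators. -/
theorem exists_reduction_of_form_mem [IsNoetherianRing R] [Infinite (ResidueField R)]
    {y : Fin r → R} (hy : IsReduction (Ideal.span (Set.range y))) {c : ℕ}
    {T : Finset (Fin r → ℕ)} (hT : ∀ b ∈ T, ∑ i, b i = c) {u : (Fin r → ℕ) → R} {a : Fin r → ℕ}
    (ha : a ∈ T) (hu : IsUnit (u a))
    (hf : ∑ b ∈ T, u b * monomialAt y b ∈ maximalIdeal R ^ (c + 1)) :
    ∃ r' < r, ∃ y' : Fin r' → R, IsReduction (Ideal.span (Set.range y')) := by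
  obtain ⟨hQ, n, hn⟩ := hy
  have hym : ∀ i, y i ∈ maximalIdeal R := fun i => hQ (Ideal.subset_span ⟨i, rfl⟩)
  obtain ⟨l, hl⟩ := exists_isUnit_eval ha hu
  -- If all `l i` were in `m`, the form would not be a unit at `l`: clear in positive degree, while
  -- in degree 0 it is the constant that `hf` places in `m`.
  obtain ⟨p, hp⟩ : ∃ p, IsUnit (l p) := by
    by_contra! h
    have hlm : ∀ i, l i ∈ maximalIdeal R := fun i => (mem_maximalIdeal _).mpr (h i)
    refine (mem_maximalIdeal _).mp ?_ hl
    rcases Nat.eq_zero_or_pos c with rfl | hc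
    · have : ∑ b ∈ T, u b * monomialAt l b = ∑ b ∈ T, u b * monomialAt y b := by
        refine Finset.sum_congr rfl fun b hb => ?_
        have hb0 : b = 0 := by
          ext i
          exact (Finset.sum_eq_zero_iff.mp (hT b hb)) i (Finset.mem_univ i)
        simp [hb0, monomialAt]
      rw [this]
      simpa using hf
    · refine Ideal.sum_mem _ fun b hb => Ideal.mul_mem_left _ _ ?_
      have := monomialAt_mem_pow hlm b
      rw [hT b hb] at this
      exact Ideal.pow_le_self hc.ne' this
  obtain ⟨r, rfl⟩ : ∃ r', r = r' + 1 := ⟨r - 1, by have := p.pos; omega⟩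
  obtain ⟨v, hv⟩ := hp.exists_right_inv
  set w := v * y p with hw
  have hwm : w ∈ maximalIdeal R := Ideal.mul_mem_left _ _ (hym p)
  -- As `v` is inverse to `l p`, one has `y p = l p * w`. Thus modulo the ideal `Q'` of these `r`
  -- elements every `y i` becomes `l i * w`: the form is restricted to the line through `l`.
  set y' : Fin r → R := fun i => y (p.succAbove i) - l (p.succAbove i) * w with hy'
  set Q' := Ideal.span (Set.range y') with hQ'
  have hyQ : ∀ i, y i - l i * w ∈ Q' := by
    intro i
    by_cases hi : i = p
    · rw [hi, hw, ← mul_assoc, hv, one_mul, sub_self]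
      exact Q'.zero_mem
    · obtain ⟨j, rfl⟩ := Fin.exists_succAbove_eq hi
      exact Ideal.subset_span ⟨j, rfl⟩
  have hQ'm : Q' ≤ maximalIdeal R := by
    rw [hQ', Ideal.span_le]
    rintro _ ⟨i, rfl⟩
    exact Ideal.sub_mem _ (hym _) (Ideal.mul_mem_left _ _ hwm)
  refine ⟨r, r.lt_succ_self, y', isReduction_of_le_sup hQ'm (n := n + c) ?_⟩
  have hQle : Ideal.span (Set.range y) ≤ Q' ⊔ Ideal.span {w} := by
    rw [Ideal.span_le]
    rintro _ ⟨i, rfl⟩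
    rw [← sub_add_cancel (y i) (l i * w)]
    exact Ideal.add_mem _ (Ideal.mem_sup_left (hyQ i))
      (Ideal.mem_sup_right (Ideal.mul_mem_left _ _ (Ideal.mem_span_singleton_self w)))
  -- Modulo `Q'` the form at `y` equals its unit value at `l` times `w^c`. Multiplying by `w` and
  -- dividing by the unit expresses `w^(c+1)` through the form, which has order at least `c + 1`,
  -- and `Q' m^c`.
  have hwc : w ^ (c + 1) ∈ Q' * maximalIdeal R ^ c ⊔ maximalIdeal R ^ (c + 2) := by
    obtain ⟨e, he⟩ := hl.exists_right_inv
    have h1 : w * (∑ b ∈ T, u b * monomialAt y b) ∈ maximalIdeal R ^ (c + 2) := by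
      rw [show c + 2 = (c + 1) + 1 from rfl, pow_succ']
      exact Ideal.mul_mem_mul hwm hf
    have h2 : w * (∑ b ∈ T, u b * (monomialAt y b - monomialAt l b * w ^ c)) ∈
        Q' * maximalIdeal R ^ c := by
      rw [Finset.mul_sum]
      refine Ideal.sum_mem _ fun b hb => ?_
      rw [mul_left_comm]
      refine Ideal.mul_mem_left _ _ ?_
      have := (congrModReduction_monomialAt hym (fun i => Ideal.mul_mem_left _ (l i) hwm) hyQ b).2.2
        w hwm
      rwa [monomialAt_mul_const, hT b hb] at this
    have h3 : w ^ (c + 1) = e * (w * (∑ b ∈ T, u b * monomialAt y b) -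
        w * (∑ b ∈ T, u b * (monomialAt y b - monomialAt l b * w ^ c))) := by
      have : ∑ b ∈ T, u b * (monomialAt y b - monomialAt l b * w ^ c) =
          ∑ b ∈ T, u b * monomialAt y b - (∑ b ∈ T, u b * monomialAt l b) * w ^ c := by
        rw [Finset.sum_mul, ← Finset.sum_sub_distrib]
        exact Finset.sum_congr rfl fun b _ => by ring
      rw [this]
      linear_combination (-w ^ (c + 1)) * he
    rw [h3]
    exact Ideal.mul_mem_left _ _ (Ideal.sub_mem _ (Ideal.mem_sup_right h1) (Ideal.mem_sup_left h2))
  have hpow : ∀ k, (Q' ⊔ Ideal.span {w}) ^ (k + 1) ≤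
      Q' * maximalIdeal R ^ k ⊔ Ideal.span {w ^ (k + 1)} := by
    intro k
    induction k with
    | zero => simp
    | succ k ih =>
      rw [pow_succ]
      refine (Ideal.mul_mono_left ih).trans ?_
      rw [Ideal.sup_mul, Ideal.mul_sup, Ideal.mul_sup, Ideal.span_singleton_mul_span_singleton,
        ← pow_succ]
      have hwle : Ideal.span {w} ≤ maximalIdeal R := (Ideal.span_singleton_le_iff_mem _).mpr hwm
      refine sup_le (sup_le ?_ ?_) (sup_le ?_ le_sup_right)
      · refine le_sup_of_le_left ?_
        rw [mul_assoc, pow_succ]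
        exact Ideal.mul_mono_right (Ideal.mul_mono_right hQ'm)
      · refine le_sup_of_le_left ?_
        rw [mul_assoc, pow_succ]
        exact Ideal.mul_mono_right (Ideal.mul_mono_right hwle)
      · refine le_sup_of_le_left ?_
        rw [mul_comm]
        exact Ideal.mul_mono_right
          ((Ideal.span_singleton_le_iff_mem _).mpr (Ideal.pow_mem_pow hwm _))
  calc maximalIdeal R ^ (n + c + 1)
      ≤ Ideal.span (Set.range y) ^ (c + 1) * maximalIdeal R ^ n := pow_add_le_of_reduction hn (c + 1)
    _ ≤ (Q' * maximalIdeal R ^ c ⊔ maximalIdeal R ^ (c + 2)) * maximalIdeal R ^ n := by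
        refine Ideal.mul_mono_left ((Ideal.pow_right_mono hQle _).trans ((hpow c).trans ?_))
        exact sup_le le_sup_left ((Ideal.span_singleton_le_iff_mem _).mpr hwc)
    _ = _ := by
        rw [Ideal.sup_mul, mul_assoc, ← pow_add, ← pow_add, add_comm c n,
          show c + 2 + n = n + c + 2 by ring]

/-- If `m^(n+1) ⊆ Q m^n`, then `m^(n+c) ⊆ Q^c m^n`, so generators of `m^0, …, m^n` in their
respective degrees suffice. The element 1 gets index 0, so that the pure monomials `y^a` come first
in the lexicographic order. -/
theorem exists_generatesPowers [IsNoetherianRing R] {y : Fin r → R}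
    (hy : IsReduction (Ideal.span (Set.range y))) :
    ∃ (t : ℕ) (g : Fin (t + 1) → R) (δ : Fin (t + 1) → ℕ),
      GeneratesPowers y g δ ∧ g 0 = 1 ∧ δ 0 = 0 := by
  obtain ⟨hQ, n, hn⟩ := hy
  have hym : ∀ i, y i ∈ maximalIdeal R := fun i => hQ (Ideal.subset_span ⟨i, rfl⟩)
  choose G hG using fun i => (IsNoetherian.noetherian (maximalIdeal R ^ i) : (maximalIdeal R ^ i).FG)
  let I := Σ i : Fin (n + 1), G i
  let e : I ≃ Fin (Fintype.card I) := Fintype.equivFin I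
  set g : Fin (Fintype.card I + 1) → R := Fin.cons 1 fun j => (e.symm j).2.1 with hg
  set δ : Fin (Fintype.card I + 1) → ℕ := Fin.cons 0 fun j => (e.symm j).1 with hδ
  have hgm : ∀ j, g j ∈ maximalIdeal R ^ δ j := by
    intro j
    refine Fin.cases (by simp [hδ]) (fun j => ?_) j
    simp only [hg, hδ, Fin.cons_succ]
    rw [← hG]
    exact Submodule.subset_span (e.symm j).2.2
  have hsurj : ∀ i ≤ n, ∀ x ∈ G i, ∃ j, g j = x ∧ δ j = i := by
    intro i hi x hx
    refine ⟨(e ⟨⟨i, Nat.lt_succ_of_le hi⟩, ⟨x, hx⟩⟩).succ, ?_, ?_⟩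
    · simp only [hg, Fin.cons_succ]
      rw [e.symm_apply_apply]
    · simp [hδ]
  refine ⟨_, g, δ, ⟨hym, fun k => le_antisymm ?_ ?_⟩, rfl, rfl⟩
  · rw [Ideal.span_le]
    rintro _ ⟨p, hp, rfl⟩
    obtain ⟨j, a, rfl⟩ := monoIdx_cases p
    have hp' : ∑ i, a i + δ j = k := hp
    rw [elt_monoIdx, ← hp', pow_add]
    exact Ideal.mul_mem_mul (monomialAt_mem_pow hym a) (hgm j)
  · rcases le_total k n with hk | hk
    · rw [← hG k]
      refine Submodule.span_le.mpr fun x hx => ?_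
      obtain ⟨j, rfl, hj⟩ := hsurj k hk x hx
      refine Ideal.subset_span ⟨monoIdx j 0, ?_, ?_⟩
      · show (monoIdx j 0).deg δ = k
        simp [deg_monoIdx, hj]
      · simp [elt_monoIdx, monomialAt]
    · obtain ⟨c, rfl⟩ := Nat.exists_eq_add_of_le hk
      refine (pow_add_le_of_reduction hn c).trans ((Ideal.mul_mono_left
        (span_range_pow_le y c)).trans ?_)
      have hGn : maximalIdeal R ^ n = Ideal.span (G n : Set R) := (hG n).symm
      rw [hGn, Ideal.span_mul_span', Ideal.span_le]
      rintro _ ⟨_, ⟨a, ha, rfl⟩, x, hx, rfl⟩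
      obtain ⟨j, rfl, hj⟩ := hsurj n le_rfl x hx
      refine Ideal.subset_span ⟨monoIdx j a, ?_, rfl⟩
      have ha' : ∑ i, a i = c := ha
      show (monoIdx j a).deg δ = n + c
      rw [deg_monoIdx, ha', hj, add_comm]

/-- Only pure monomials precede `y^a`, so if it were not standard, a form in `y` with coefficient 1
at `a` would lie in `m^(|a|+1)`, and `exists_reduction_of_form_mem` would contradict minimality. -/
theorem GeneratesPowers.isStd_zero [IsNoetherianRing R] [Infinite (ResidueField R)]
    {y : Fin r → R} (hy : IsReduction (Ideal.span (Set.range y)))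
    (hmin : ∀ r' < r, ∀ y' : Fin r' → R, ¬ IsReduction (Ideal.span (Set.range y')))
    {g : Fin (t + 1) → R} {δ : Fin (t + 1) → ℕ} (hg : g 0 = 1) (hδ : δ 0 = 0) (a : Fin r → ℕ) :
    (monoIdx 0 a).IsStd y g δ := by
  classical
  intro h
  have hdeg : ∀ b : Fin r → ℕ, (monoIdx (0 : Fin (t + 1)) b).deg δ = ∑ i, b i := fun b => by
    rw [deg_monoIdx, hδ, add_zero]
  have helt : ∀ b : Fin r → ℕ, (monoIdx (0 : Fin (t + 1)) b).elt y g = monomialAt y b := fun b => by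
    rw [elt_monoIdx, hg, mul_one]
  rw [hdeg, helt] at h
  have hfin : {b : Fin r → ℕ | ∑ i, b i = ∑ i, a i ∧ b ≠ a}.Finite :=
    (finite_setOf_sum_lt r (∑ i, a i + 1)).subset fun b hb => Nat.lt_succ_of_le hb.1.le
  have hsub : MonoIdx.elt y g '' {q | q.deg δ = ∑ i, a i ∧ q < monoIdx 0 a} ⊆
      monomialAt y '' (hfin.toFinset : Set (Fin r → ℕ)) := by
    rintro _ ⟨q, ⟨hq1, hq2⟩, rfl⟩
    obtain ⟨j, b, rfl⟩ := monoIdx_cases q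
    have hj : j = 0 ∧ toLex b < toLex a := by
      rw [monoIdx, monoIdx, Prod.Lex.toLex_lt_toLex] at hq2
      exact hq2.resolve_left (Fin.not_lt_zero _)
    obtain ⟨rfl, hb⟩ := hj
    rw [hdeg] at hq1
    refine ⟨b, ?_, (helt b).symm⟩
    rw [Set.Finite.coe_toFinset]
    exact ⟨hq1, fun h => hb.ne (by rw [h])⟩
  have h2 := sup_le_sup_left (Ideal.span_mono hsub) _ h
  obtain ⟨z, hz, x, hx, hzx⟩ := Submodule.mem_sup.mp h2
  obtain ⟨v, hv⟩ : ∃ v : (Fin r → ℕ) → R, ∑ b ∈ hfin.toFinset, v b • monomialAt y b = x := by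
    obtain ⟨v, hv⟩ := (Submodule.mem_span_image_finset_iff_exists_fun R).mp hx
    refine ⟨fun b => if h : b ∈ hfin.toFinset then v ⟨b, h⟩ else 0, ?_⟩
    rw [← hv, ← Finset.sum_coe_sort]
    exact Finset.sum_congr rfl fun b _ => by
      beta_reduce
      rw [dif_pos b.2]
  obtain ⟨r', hr', y', hy'⟩ := exists_reduction_of_form_mem hy (c := ∑ i, a i)
    (T := insert a hfin.toFinset) (u := fun b => if b = a then 1 else - v b) (a := a)
    (fun b hb => by
      rcases Finset.mem_insert.mp hb with rfl | hb
      · rfl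
      · exact ((Set.Finite.mem_toFinset _).mp hb).1)
    (Finset.mem_insert_self _ _) (by simp) (by
      rw [Finset.sum_insert (by simp), if_pos rfl, one_mul]
      have : ∑ b ∈ hfin.toFinset, (if b = a then 1 else - v b) * monomialAt y b = - x := by
        rw [← hv, ← Finset.sum_neg_distrib]
        refine Finset.sum_congr rfl fun b hb => ?_
        rw [if_neg ((Set.Finite.mem_toFinset _).mp hb).2, smul_eq_mul, neg_mul]
      rw [this, ← hzx]
      simpa using hz)
  exact hmin r' hr' y' hy'

end Reductions

/-! ### Hilbert–Samuel polynomial, multiplicity, and the size of a minimal reduction. -/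

section HilbertSamuel

open Polynomial

variable {R : Type*} [CommRing R] [IsLocalRing R] {r t : ℕ}

open Classical in
/-- The number of indices all of whose monomials are standard. -/
noncomputable def GeneratesPowers.rank {y : Fin r → R} {g : Fin t → R} {δ : Fin t → ℕ}
    (_ : GeneratesPowers y g δ) : ℕ :=
  (Finset.univ.filter fun j => {a | (monoIdx j a).IsStd y g δ} = Set.univ).card

theorem GeneratesPowers.exists_polynomial {y : Fin r → R} {g : Fin t → R} {δ : Fin t → ℕ}
    (h : GeneratesPowers y g δ) : ∃ p : ℚ[X], p.natDegree ≤ r ∧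
      p.coeff r = h.rank * (r ! : ℚ)⁻¹ ∧ ValueSemigroup.IsHilbertSamuelPoly R p := by
  classical
  choose p p1 p2 p3 using fun j => exists_polynomial_isLowerSet (h.isLowerSet j)
  -- The index `j` contributes exponents with `|a| < n - δ j`; shifting the variable does not affect
  -- the coefficient in degree `r`.
  refine ⟨∑ j, (p j).comp (X - C ((δ j : ℕ) : ℚ)),
    natDegree_sum_le_of_forall_le _ _ fun j _ => (coeff_comp_X_sub_C (p1 j) _).1, ?_, ?_⟩
  · rw [finsetSum_coeff]
    simp_rw [(coeff_comp_X_sub_C (p1 _) _).2, p2]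
    rw [← Finset.sum_filter, Finset.sum_const, nsmul_eq_mul]
    rfl
  · have h1 : ∀ᶠ n : ℕ in atTop, ∀ j, δ j ≤ n ∧
        ({a : Fin r → ℕ | a ∈ {a | (monoIdx j a).IsStd y g δ} ∧ ∑ i, a i < n - δ j}.ncard : ℚ) =
          (p j).eval ((n - δ j : ℕ) : ℚ) :=
      eventually_all.mpr fun j =>
        (eventually_ge_atTop (δ j)).and ((tendsto_sub_atTop_nat (δ j)).eventually (p3 j))
    filter_upwards [h1] with n hn
    refine ⟨_, h.length_pow n, ?_⟩
    rw [ncard_monoIdx ((MonoIdx.finite_deg_lt δ n).subset fun p hp => hp.2), eval_finsetSum,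
      Nat.cast_sum]
    refine Finset.sum_congr rfl fun j _ => ?_
    rw [eval_comp, eval_sub, eval_X, eval_C, ← Nat.cast_sub (hn j).1, ← (hn j).2]
    congr 2
    ext a
    simp only [Set.mem_ofPred_eq, deg_monoIdx]
    exact and_congr_right fun _ => Nat.lt_sub_iff_add_lt

theorem GeneratesPowers.rank_pos {y : Fin r → R} {g : Fin (t + 1) → R} {δ : Fin (t + 1) → ℕ}
    (h : GeneratesPowers y g δ) (h0 : ∀ a, (monoIdx 0 a).IsStd y g δ) : 0 < h.rank :=
  Finset.card_pos.mpr ⟨0, Finset.mem_filter.mpr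
    ⟨Finset.mem_univ _, Set.eq_univ_of_forall h0⟩⟩

theorem hilbertSamuelPoly_eq {p : ℚ[X]} (hp : ValueSemigroup.IsHilbertSamuelPoly R p) :
    ValueSemigroup.hilbertSamuelPoly R = p := by
  have hex : ∃ P, ValueSemigroup.IsHilbertSamuelPoly R P := ⟨p, hp⟩
  rw [ValueSemigroup.hilbertSamuelPoly, dif_pos hex]
  obtain ⟨N, hN⟩ := eventually_atTop.mp (hex.choose_spec.and hp)
  refine eq_of_infinite_eval_eq _ _ (Set.Infinite.mono ?_
    ((Set.Ici_infinite N).image (Nat.cast_injective (R := ℚ)).injOn))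
  rintro _ ⟨n, hn, rfl⟩
  obtain ⟨⟨l, h1, h2⟩, l', h3, h4⟩ := hN n hn
  have : l = l' := by exact_mod_cast h1.symm.trans h3
  show eval _ _ = eval _ _
  rw [h2, h4, this]

theorem maximalIdeal_mem_minimalPrimes {Q : Ideal R} (hQ : Q ≤ maximalIdeal R) {n : ℕ}
    (h : maximalIdeal R ^ n ≤ Q) : maximalIdeal R ∈ Q.minimalPrimes :=
  ⟨⟨inferInstance, hQ⟩, fun _ hP _ => hP.1.le_of_pow_le (h.trans hP.2)⟩

variable [IsNoetherianRing R]

theorem ringKrullDim_le_of_reduction {y : Fin r → R}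
    (hy : IsReduction (Ideal.span (Set.range y))) : ringKrullDim R ≤ r := by
  obtain ⟨hQ, n, hn⟩ := hy
  have h1 := Ideal.height_le_card_of_mem_minimalPrimes_span (Set.finite_range y)
    (maximalIdeal_mem_minimalPrimes hQ (hn.trans Ideal.mul_le_left))
  have h2 : (Set.range y).ncard ≤ r := by
    rw [← Set.image_univ]
    exact (Set.ncard_image_le Set.finite_univ).trans (by simp [Set.ncard_univ])
  rw [← maximalIdeal_height_eq_ringKrullDim]
  exact_mod_cast h1.trans (Nat.cast_le.mpr h2)

theorem exists_system_of_parameters {d : ℕ} (hd : ringKrullDim R = d) :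
    ∃ (z : Fin d → R) (c : ℕ), Ideal.span (Set.range z) ≤ maximalIdeal R ∧
      maximalIdeal R ^ c ≤ Ideal.span (Set.range z) := by
  obtain ⟨s, hs, hcard⟩ :=
    Ideal.exists_finset_card_eq_height_of_isNoetherianRing (maximalIdeal R)
  have hsd : s.card = d := by
    rw [← maximalIdeal_height_eq_ringKrullDim, ← hcard] at hd
    exact_mod_cast hd
  have hrange : Set.range (fun i => ((s.equivFinOfCardEq hsd).symm i : R)) = s := by
    rw [Set.range_comp' Subtype.val, Equiv.range_eq_univ]
    simp
  obtain ⟨c, hc⟩ := Ideal.exists_pow_le_of_le_radical_of_fg (I := maximalIdeal R)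
    (J := Ideal.span (s : Set R)) (by
      rw [Ideal.radical_eq_sInf]
      exact le_sInf fun P hP => hs.2 ⟨hP.2, hP.1⟩ (le_maximalIdeal hP.2.ne_top))
    (IsNoetherian.noetherian _)
  exact ⟨_, c, hrange ▸ hs.1.2, hrange ▸ hc⟩

/-- Positive rank makes `ℓ(R/m^n)` grow like a positive multiple of `n^r`, whereas for a parameter
ideal `Q` it is at most `ℓ(R/Q^n) = O(n^d)`. -/
theorem GeneratesPowers.le_of_ringKrullDim_eq {y : Fin r → R} {g : Fin t → R} {δ : Fin t → ℕ}
    (h : GeneratesPowers y g δ) (hpos : 0 < h.rank) {d : ℕ} (hd : ringKrullDim R = d) : r ≤ d := by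
  by_contra! hrd
  obtain ⟨z, c, hz, hc⟩ := exists_system_of_parameters hd
  obtain ⟨p, p1, p2, p3⟩ := h.exists_polynomial
  obtain ⟨q, q1, -, q3⟩ := exists_polynomial_simplex d
  set Q := Ideal.span (Set.range z)
  obtain ⟨L, hL⟩ : ∃ L : ℕ, Module.length R (R ⧸ Q) ≤ L :=
    ⟨_, (length_quotient_anti hc).trans (h.length_pow c).le⟩
  have hle : ∀ᶠ n : ℕ in atTop, p.eval (n : ℚ) ≤ (C (L : ℚ) * q).eval (n : ℚ) := by
    filter_upwards [p3, eventually_ge_atTop 1] with n hn hn1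
    obtain ⟨l, hl1, hl2⟩ := hn
    rw [hl2, eval_mul, eval_C, ← q3 n hn1, mul_comm]
    have h1 : (l : ℕ∞) ≤ ({a : Fin d → ℕ | ∑ i, a i < n}.ncard : ℕ∞) * L :=
      hl1 ▸ (length_quotient_anti (Ideal.pow_right_mono hz n)).trans
        ((length_quotient_span_pow_le z n).trans (mul_le_mul_right hL _))
    exact_mod_cast h1
  have hq : (C (L : ℚ) * q).natDegree < r := ((natDegree_C_mul_le _ _).trans q1).trans_lt hrd
  have := le_of_tendsto_of_tendsto (tendsto_eval_div_pow p1) (tendsto_eval_div_pow hq.le)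
    (hle.mono fun n hn => by
      have : ((p.eval (n : ℚ) : ℚ) : ℝ) ≤ (((C (L : ℚ) * q).eval (n : ℚ) : ℚ) : ℝ) := by
        exact_mod_cast hn
      beta_reduce
      gcongr)
  rw [coeff_eq_zero_of_natDegree_lt hq, p2] at this
  have h2 : (0 : ℚ) < h.rank * (r ! : ℚ)⁻¹ := by positivity
  have h3 : (h.rank * (r ! : ℚ)⁻¹ : ℚ) ≤ 0 := by exact_mod_cast this
  exact absurd h3 (not_le.mpr h2)

/-- Over an infinite residue field, the maximal ideal has a reduction generated by `dim R`
elements, and no reduction has fewer generators. -/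
theorem exists_minimal_reduction [Infinite (ResidueField R)] {d : ℕ} (hd : ringKrullDim R = d) :
    (∃ y : Fin d → R, IsReduction (Ideal.span (Set.range y))) ∧
      ∀ r' < d, ∀ y' : Fin r' → R, ¬ IsReduction (Ideal.span (Set.range y')) := by
  classical
  have hex : ∃ r, ∃ y : Fin r → R, IsReduction (Ideal.span (Set.range y)) := by
    obtain ⟨s, hs⟩ := (IsNoetherian.noetherian (maximalIdeal R) : (maximalIdeal R).FG)
    refine ⟨s.card, fun i => (s.equivFin.symm i : R), ?_⟩
    rw [Set.range_comp' Subtype.val, Equiv.range_eq_univ]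
    have : Ideal.span (s : Set R) = maximalIdeal R := hs
    simp only [Set.image_univ, Subtype.range_coe_subtype, Finset.setOfPred_mem, this]
    exact ⟨le_rfl, 0, by simp⟩
  obtain ⟨y, hy⟩ := Nat.find_spec hex
  have hmin : ∀ r' < Nat.find hex, ∀ y' : Fin r' → R, ¬ IsReduction (Ideal.span (Set.range y')) :=
    fun r' hr' y' hy' => Nat.find_min hex hr' ⟨y', hy'⟩
  obtain ⟨t, g, δ, h, hg, hδ⟩ := exists_generatesPowers hy
  -- For the least possible number of generators, analytic independence gives positive rank and
  -- hence the upper bound `d`; the lower bound is Krull's height theorem.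
  have h1 := h.le_of_ringKrullDim_eq
    (h.rank_pos (GeneratesPowers.isStd_zero hy hmin hg hδ)) hd
  have h2 := ringKrullDim_le_of_reduction hy
  rw [hd] at h2
  have : Nat.find hex = d := le_antisymm h1 (by exact_mod_cast h2)
  rw [← this]
  exact ⟨⟨y, hy⟩, hmin⟩

end HilbertSamuel

/-! ### Value ideals and generators of large value. -/

section Valuations

open ValueSemigroup

variable {R : Type*} [CommRing R] {K : Type*} [Field K] [Algebra R K]
  {ν : AddValuation K (WithTop ℝ)}

theorem span_range_sub_mul {d : ℕ} (y : Fin d → R) (c : Fin d → R) (q : Fin d) (hc : c q = 0) :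
    Ideal.span (Set.range fun i => y i - c i * y q) = Ideal.span (Set.range y) := by
  apply le_antisymm
  · rw [Ideal.span_le]
    rintro _ ⟨i, rfl⟩
    exact Ideal.sub_mem _ (Ideal.subset_span ⟨i, rfl⟩)
      (Ideal.mul_mem_left _ _ (Ideal.subset_span ⟨q, rfl⟩))
  · rw [Ideal.span_le]
    rintro _ ⟨i, rfl⟩
    have hq : y q ∈ Ideal.span (Set.range fun i => y i - c i * y q) :=
      Ideal.subset_span ⟨q, by simp [hc]⟩
    have hi : y i - c i * y q ∈ Ideal.span (Set.range fun i => y i - c i * y q) :=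
      Ideal.subset_span ⟨i, rfl⟩
    have := Ideal.add_mem _ hi (Ideal.mul_mem_left _ (c i) hq)
    rwa [sub_add_cancel] at this

theorem ValueSemigroup.le_valuation_monomialAt {d : ℕ} {y : Fin d → R}
    {s : Fin d → ℝ} (hy : ∀ i, (s i : WithTop ℝ) ≤ ν (algebraMap R K (y i))) (a : Fin d → ℕ) :
    ((∑ i, a i * s i : ℝ) : WithTop ℝ) ≤ ν (algebraMap R K (monomialAt y a)) := by
  rw [monomialAt]
  induction (Finset.univ : Finset (Fin d)) using Finset.induction_on with
  | empty => simp
  | insert i S hi ih =>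
    rw [Finset.sum_insert hi, Finset.prod_insert hi, map_mul, AddValuation.map_mul, WithTop.coe_add]
    refine add_le_add ?_ ih
    rw [map_pow, AddValuation.map_pow]
    calc ((a i * s i : ℝ) : WithTop ℝ) = a i • (s i : WithTop ℝ) := by
          rw [← WithTop.coe_nsmul, nsmul_eq_mul]
      _ ≤ _ := nsmul_le_nsmul_right (hy i) _

variable [IsLocalRing R]

theorem ValueSemigroup.mem_valuationRing_iff {x : K} : x ∈ valuationRing ν ↔ 0 ≤ ν x := by
  rw [Valuation.mem_valuationSubring_iff]
  exact Iff.rfl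

theorem ValueSemigroup.pos_of_mem_maximalIdeal {x : valuationRing ν}
    (hx : x ∈ maximalIdeal (valuationRing ν)) : 0 < ν x.1 := by
  refine (mem_valuationRing_iff.mp x.2).lt_of_ne fun h0 => ?_
  refine (mem_maximalIdeal _).mp hx ?_
  have hne : x.1 ≠ 0 := by
    intro h
    rw [h, AddValuation.map_zero] at h0
    exact WithTop.zero_ne_top h0
  have hinv : x.1⁻¹ ∈ valuationRing ν := by
    rw [mem_valuationRing_iff]
    have := AddValuation.map_mul ν x.1 x.1⁻¹
    rw [mul_inv_cancel₀ hne, AddValuation.map_one, ← h0, zero_add] at this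
    exact this.le
  exact IsUnit.of_mul_eq_one ⟨x.1⁻¹, hinv⟩ (Subtype.ext (mul_inv_cancel₀ hne))

theorem ValueSemigroup.Dominates.nonneg (hν : Dominates R ν) (f : R) :
    0 ≤ ν (algebraMap R K f) := mem_valuationRing_iff.mp (hν.mem f)

/-- The ideal of elements of value at least `x`. -/
def ValueSemigroup.Dominates.idealGE (hν : Dominates R ν) (x : WithTop ℝ) : Ideal R where
  carrier := {f | x ≤ ν (algebraMap R K f)}
  zero_mem' := by simp
  add_mem' {f g} hf hg := by
    show x ≤ ν (algebraMap R K (f + g))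
    rw [map_add]
    exact AddValuation.map_le_add ν hf hg
  smul_mem' c f hf := by
    show x ≤ ν (algebraMap R K (c * f))
    rw [map_mul, AddValuation.map_mul]
    exact le_add_of_nonneg_of_le (hν.nonneg c) hf

theorem ValueSemigroup.Dominates.mem_idealGE {hν : Dominates R ν} {x : WithTop ℝ} {f : R} :
    f ∈ hν.idealGE x ↔ x ≤ ν (algebraMap R K f) := Iff.rfl

/-- The ideal of elements of value greater than `x`. -/
def ValueSemigroup.Dominates.idealGT (hν : Dominates R ν) (x : ℝ) : Ideal R where
  carrier := {f | (x : WithTop ℝ) < ν (algebraMap R K f)}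
  zero_mem' := by simp
  add_mem' {f g} hf hg := by
    show _ < ν (algebraMap R K (f + g))
    rw [map_add]
    exact AddValuation.map_lt_add ν hf hg
  smul_mem' c f hf := by
    show _ < ν (algebraMap R K (c * f))
    rw [map_mul, AddValuation.map_mul]
    exact lt_of_lt_of_le hf (le_add_of_nonneg_left (hν.nonneg c))

theorem ValueSemigroup.Dominates.mem_idealGT {hν : Dominates R ν} {x : ℝ} {f : R} :
    f ∈ hν.idealGT x ↔ (x : WithTop ℝ) < ν (algebraMap R K f) := Iff.rfl

/-- Distinct values below `n` give a strict chain of ideals above the ideal of elements of value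
at least `n`. -/
theorem ValueSemigroup.Dominates.phi_le (hν : Dominates R ν) (n : ℕ) :
    phi R ν n ≤ Module.length R (R ⧸ hν.idealGE (n : ℝ)) := by
  have key : ∀ T : Finset ℝ, (T : Set ℝ) ⊆ valueSemigroup R ν ∩ Set.Ioo 0 (n : ℝ) →
      (T.card : ℕ∞) ≤ Module.length R (R ⧸ hν.idealGE (n : ℝ)) := by
    intro T hT
    have hex : ∀ τ : ℝ, ∃ f : R, τ ∈ T → ν (algebraMap R K f) = (τ : WithTop ℝ) := by
      intro τ
      by_cases h : τ ∈ T
      · obtain ⟨f, -, -, hf⟩ := (hT h).1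
        exact ⟨f, fun _ => hf⟩
      · exact ⟨0, fun h' => absurd h' h⟩
    choose f hf using hex
    -- The dual order lists the values from largest to smallest, so `idealGE n` and the predecessors
    -- of `τ` all lie in `idealGT τ`, which does not contain `f τ`.
    have := card_le_length_quotient (hν.idealGE (n : ℝ)) (fun τ : ℝᵒᵈ => f (OrderDual.ofDual τ))
      (T.map OrderDual.toDual.toEmbedding) (by
        intro τ hτ hmem
        have hτT : OrderDual.ofDual τ ∈ T := by simpa using hτ
        have hle : hν.idealGE (n : ℝ) ⊔ Ideal.span ((fun τ : ℝᵒᵈ => f (OrderDual.ofDual τ)) ''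
            {σ | σ ∈ T.map OrderDual.toDual.toEmbedding ∧ σ < τ}) ≤
            hν.idealGT (OrderDual.ofDual τ) := by
          refine sup_le (fun g hg => ?_) (Ideal.span_le.mpr ?_)
          · refine lt_of_lt_of_le ?_ (Dominates.mem_idealGE.mp hg)
            exact WithTop.coe_lt_coe.mpr (hT hτT).2.2
          · rintro _ ⟨σ, ⟨hσ, hlt⟩, rfl⟩
            have hσT : OrderDual.ofDual σ ∈ T := by simpa using hσ
            refine Dominates.mem_idealGT.mpr ?_
            rw [hf _ hσT]
            exact WithTop.coe_lt_coe.mpr hlt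
        have := Dominates.mem_idealGT.mp (hle hmem)
        rw [hf _ hτT] at this
        exact lt_irrefl _ this)
    simpa using this
  rw [phi]
  by_cases hfin : (valueSemigroup R ν ∩ Set.Ioo 0 (n : ℝ)).Finite
  · rw [hfin.encard_eq_coe_toFinset_card]
    exact key _ (by simp)
  · rw [Set.encard_eq_top_iff.mpr hfin, top_le_iff, ENat.eq_top_iff_forall_ge]
    intro k
    obtain ⟨T, hT, hk⟩ := Set.Infinite.exists_subset_card_eq hfin k
    exact hk ▸ key T hT

/-- The quotient `f/g` has value 0, so it lies in `V`, and its residue is that of some `c` in `R`.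
Then `f/g - c` has positive value. -/
theorem ValueSemigroup.Dominates.exists_lt_sub (hν : Dominates R ν)
    (hV : Function.Surjective hν.residueFieldMap) {f g : R} {x : ℝ}
    (hf : ν (algebraMap R K f) = x) (hg : ν (algebraMap R K g) = x) :
    ∃ c : R, (x : WithTop ℝ) < ν (algebraMap R K (f - c * g)) := by
  have := hν.isLocalHom
  have hg0 : algebraMap R K g ≠ 0 := by
    intro h
    rw [h, AddValuation.map_zero] at hg
    exact WithTop.top_ne_coe hg
  set q : K := algebraMap R K f / algebraMap R K g with hq
  have hqg : q * algebraMap R K g = algebraMap R K f := div_mul_cancel₀ _ hg0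
  have hνq : ν q = 0 := by
    have := AddValuation.map_mul ν q (algebraMap R K g)
    rw [hqg, hf, hg] at this
    have h2 : (0 : WithTop ℝ) + x = ν q + x := by rw [zero_add]; exact this
    exact (WithTop.add_right_cancel WithTop.coe_ne_top h2).symm
  have hqV : q ∈ valuationRing ν := mem_valuationRing_iff.mpr hνq.ge
  obtain ⟨c', hc'⟩ := hV (residue _ ⟨q, hqV⟩)
  obtain ⟨c, rfl⟩ := residue_surjective c'
  refine ⟨c, ?_⟩
  have hres : residue (valuationRing ν) (hν.inclusion c) = residue _ ⟨q, hqV⟩ := hc'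
  have hmem : (⟨q, hqV⟩ - hν.inclusion c : valuationRing ν) ∈ maximalIdeal (valuationRing ν) := by
    rw [← residue_eq_zero_iff, map_sub, hres, sub_self]
  have hpos := pos_of_mem_maximalIdeal hmem
  have hval : ((⟨q, hqV⟩ - hν.inclusion c : valuationRing ν) : K) = q - algebraMap R K c := rfl
  rw [hval] at hpos
  have : algebraMap R K (f - c * g) = (q - algebraMap R K c) * algebraMap R K g := by
    rw [sub_mul, hqg, map_sub, map_mul]
  rw [this, AddValuation.map_mul, hg]
  have h3 := WithTop.add_lt_add_right (WithTop.coe_ne_top (a := x)) hpos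
  rwa [zero_add] at h3

/-- One elimination step on the generators of an ideal. -/
theorem ValueSemigroup.Dominates.exists_pivot (hν : Dominates R ν)
    (hV : Function.Surjective hν.residueFieldMap) {d : ℕ} (y : Fin d → R) (q : Fin d) (x : ℝ)
    (hx : ∀ i, q ≤ i → (x : WithTop ℝ) ≤ ν (algebraMap R K (y i))) :
    ∃ y' : Fin d → R, Ideal.span (Set.range y') = Ideal.span (Set.range y) ∧
      (∀ i < q, y' i = y i) ∧ (∀ i, q ≤ i → (x : WithTop ℝ) ≤ ν (algebraMap R K (y' i))) ∧
      ∀ i, q < i → (x : WithTop ℝ) < ν (algebraMap R K (y' i)) := by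
  classical
  by_cases hex : ∃ i, q ≤ i ∧ ν (algebraMap R K (y i)) = x
  · obtain ⟨i₀, hi₀, hvi₀⟩ := hex
    -- A generator of value exactly `x` is moved to position `q`; subtracting multiples of it raises
    -- the later generators of value `x` above `x`.
    set y₁ : Fin d → R := y ∘ Equiv.swap q i₀ with hy₁
    have h1q : ν (algebraMap R K (y₁ q)) = x := by simpa [hy₁] using hvi₀
    have hspan₁ : Set.range y₁ = Set.range y := (Equiv.swap q i₀).surjective.range_comp y
    have hlt₁ : ∀ i < q, y₁ i = y i := fun i hi => by
      simp only [hy₁, Function.comp]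
      rw [Equiv.swap_apply_of_ne_of_ne hi.ne (hi.trans_le hi₀).ne]
    have hge₁ : ∀ i, q ≤ i → (x : WithTop ℝ) ≤ ν (algebraMap R K (y₁ i)) := by
      intro i hi
      refine hx _ ?_
      rw [Equiv.swap_apply_def]
      split_ifs <;> [exact hi₀; exact le_rfl; exact hi]
    have hc : ∀ i, ∃ c : R, (i ≤ q → c = 0) ∧
        (q < i → (x : WithTop ℝ) < ν (algebraMap R K (y₁ i - c * y₁ q))) := by
      intro i
      rcases le_or_gt i q with hi | hi
      · exact ⟨0, fun _ => rfl, fun h => absurd hi (not_le.mpr h)⟩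
      · rcases (hge₁ i hi.le).lt_or_eq with h | h
        · exact ⟨0, fun _ => rfl, fun _ => by simpa using h⟩
        · obtain ⟨c, hc⟩ := hν.exists_lt_sub hV h.symm h1q
          exact ⟨c, fun h => absurd hi (not_lt.mpr h), fun _ => hc⟩
    choose c hc0 hc1 using hc
    refine ⟨fun i => y₁ i - c i * y₁ q, ?_, fun i hi => ?_, fun i hi => ?_, hc1⟩
    · rw [span_range_sub_mul y₁ c q (hc0 q le_rfl), hspan₁]
    · simp [hc0 i hi.le, hlt₁ i hi]
    · rcases hi.eq_or_lt with rfl | hi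
      · simpa [hc0 q le_rfl] using h1q.ge
      · exact (hc1 i hi).le
  · push Not at hex
    exact ⟨y, rfl, fun _ _ => rfl, hx, fun i hi => (hx i hi.le).lt_of_ne (hex i hi.le).symm⟩

theorem ValueSemigroup.IsFirstElements.strictMono {d : ℕ} {S : Set ℝ} {s : Fin d → ℝ}
    (hs : IsFirstElements S s) : StrictMono s := by
  intro i j hij
  refine lt_of_le_of_ne ((hs i).2 ⟨(hs j).1.1, ?_⟩) fun h => (hs j).1.2 ⟨i, hij, h⟩
  rintro ⟨k, hk, h⟩
  exact (hs j).1.2 ⟨k, lt_trans hk hij, h⟩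

variable [IsFractionRing R K]

theorem ValueSemigroup.exists_mem_valueSemigroup {f : R} (hf : f ∈ maximalIdeal R) (h0 : f ≠ 0) :
    ∃ x ∈ valueSemigroup R ν, ν (algebraMap R K f) = (x : WithTop ℝ) := by
  have : ν (algebraMap R K f) ≠ ⊤ := by
    rw [Ne, AddValuation.top_iff]
    simpa using h0
  obtain ⟨x, hx⟩ := WithTop.ne_top_iff_exists.mp this
  exact ⟨x, ⟨f, hf, h0, hx.symm⟩, hx.symm⟩

/-- An ideal generated by `d` elements of the maximal ideal has generators whose values are at
least the first `d` elements of the value semigroup. -/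
theorem ValueSemigroup.Dominates.exists_generators_le (hν : Dominates R ν)
    (hV : Function.Surjective hν.residueFieldMap) {d : ℕ} {s : Fin d → ℝ}
    (hs : IsFirstElements (valueSemigroup R ν) s) (y : Fin d → R)
    (hy : Ideal.span (Set.range y) ≤ maximalIdeal R) :
    ∃ y' : Fin d → R, Ideal.span (Set.range y') = Ideal.span (Set.range y) ∧
      ∀ i, (s i : WithTop ℝ) ≤ ν (algebraMap R K (y' i)) := by
  -- The strict inequalities drive the induction: a value exceeding all earlier `s j` is at least
  -- the next one, because `s q` is least among the remaining elements of the semigroup.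
  suffices H : ∀ p ≤ d, ∃ y' : Fin d → R, Ideal.span (Set.range y') = Ideal.span (Set.range y) ∧
      ∀ i j : Fin d, (j : ℕ) < p → (j ≤ i → (s j : WithTop ℝ) ≤ ν (algebraMap R K (y' i))) ∧
        (j < i → (s j : WithTop ℝ) < ν (algebraMap R K (y' i))) by
    obtain ⟨y', h1, h2⟩ := H d le_rfl
    exact ⟨y', h1, fun i => (h2 i i i.2).1 le_rfl⟩
  intro p
  induction p with
  | zero => exact fun _ => ⟨y, rfl, fun i j h => absurd h (Nat.not_lt_zero _)⟩
  | succ p ih =>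
    intro hp
    obtain ⟨y₁, h1, h2⟩ := ih (Nat.le_of_succ_le hp)
    set q : Fin d := ⟨p, hp⟩ with hq
    have hx : ∀ i, q ≤ i → (s q : WithTop ℝ) ≤ ν (algebraMap R K (y₁ i)) := by
      intro i hi
      by_cases h0 : y₁ i = 0
      · simp [h0]
      · obtain ⟨x, hxS, hxe⟩ := exists_mem_valueSemigroup (ν := ν)
          (hy (h1 ▸ Ideal.subset_span ⟨i, rfl⟩ : y₁ i ∈ Ideal.span (Set.range y))) h0
        rw [hxe]
        refine WithTop.coe_le_coe.mpr ((hs q).2 ⟨hxS, ?_⟩)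
        rintro ⟨j, hj, rfl⟩
        have := (h2 i j hj).2 (lt_of_lt_of_le hj hi)
        rw [hxe] at this
        exact lt_irrefl _ this
    obtain ⟨y₂, g1, g2, g3, g4⟩ := hν.exists_pivot hV y₁ q (s q) hx
    refine ⟨y₂, g1.trans h1, fun i j hj => ?_⟩
    rcases Nat.lt_succ_iff_lt_or_eq.mp hj with hj | hj
    · rcases lt_or_ge i q with hi | hi
      · rw [g2 i hi]
        exact h2 i j hj
      · have : (s j : WithTop ℝ) < ν (algebraMap R K (y₂ i)) :=
          lt_of_lt_of_le (WithTop.coe_lt_coe.mpr (hs.strictMono (show j < q from hj))) (g3 i hi)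
        exact ⟨fun _ => this.le, fun _ => this⟩
    · obtain rfl : j = q := Fin.ext hj
      exact ⟨g3 i, g4 i⟩

theorem ValueSemigroup.Dominates.pow_le_idealGE (hν : Dominates R ν)
    (h1 : IsLeast (valueSemigroup R ν) 1) (n : ℕ) :
    maximalIdeal R ^ n ≤ hν.idealGE (n : ℝ) := by
  induction n with
  | zero => exact fun f _ => by simpa [Dominates.mem_idealGE] using hν.nonneg f
  | succ n ih =>
    rw [pow_succ, Ideal.mul_le]
    intro f hf g hg
    rw [Dominates.mem_idealGE, map_mul, AddValuation.map_mul]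
    have hg1 : ((1 : ℝ) : WithTop ℝ) ≤ ν (algebraMap R K g) := by
      by_cases h0 : g = 0
      · simp [h0]
      · obtain ⟨x, hxS, hxe⟩ := exists_mem_valueSemigroup (ν := ν) hg h0
        rw [hxe]
        exact WithTop.coe_le_coe.mpr (h1.2 hxS)
    push_cast
    exact add_le_add (Dominates.mem_idealGE.mp (ih hf)) hg1

end Valuations

/-! ### Asymptotics of the weighted counts. -/

section Asymptotics

open Polynomial

theorem tendsto_pow_add_div_pow (d : ℕ) (S c : ℝ) :
    Tendsto (fun n : ℕ => ((n : ℝ) + S) ^ d / c / (n : ℝ) ^ d) atTop (𝓝 c⁻¹) := by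
  have h1 : Tendsto (fun n : ℕ => (1 + S * (n : ℝ)⁻¹) ^ d * c⁻¹) atTop (𝓝 ((1 + S * 0) ^ d * c⁻¹)) :=
    (((tendsto_inv_atTop_nhds_zero_nat (𝕜 := ℝ)).const_mul S).const_add 1).pow d |>.mul_const _
  have h2 : (1 + S * 0) ^ d * c⁻¹ = c⁻¹ := by simp
  rw [h2] at h1
  refine h1.congr' ?_
  filter_upwards [eventually_ge_atTop 1] with n hn
  have hn' : (n : ℝ) ≠ 0 := by positivity
  rw [show 1 + S * (n : ℝ)⁻¹ = (n + S) / n by field_simp, div_pow]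
  ring

open Classical in
-- The weights matter only for full `D`, where the simplex volume bound applies. Otherwise they are
-- dropped using `s i ≥ 1`, and the count is already `o(n^d)`.
theorem exists_weighted_count_bound {d : ℕ} {D : Set (Fin d → ℕ)} (hD : IsLowerSet D)
    {s : Fin d → ℝ} (hs : ∀ i, 1 ≤ s i) :
    ∃ b : ℕ → ℝ, Tendsto (fun n : ℕ => b n / (n : ℝ) ^ d) atTop
        (𝓝 (if D = Set.univ then ((d ! : ℝ) * ∏ i, s i)⁻¹ else 0)) ∧
      ∀ᶠ n : ℕ in atTop, ({a : Fin d → ℕ | a ∈ D ∧ ∑ i, a i * s i < n}.ncard : ℝ) ≤ b n := by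
  by_cases hu : D = Set.univ
  · refine ⟨fun n => ((n : ℝ) + ∑ i, s i) ^ d / (d ! * ∏ i, s i), ?_, Eventually.of_forall ?_⟩
    · rw [if_pos hu]
      exact tendsto_pow_add_div_pow d _ _
    · intro n
      simpa [hu] using (ncard_weight_lt_le d s (fun i => one_pos.trans_le (hs i)) n
        (Nat.cast_nonneg n)).2
  · obtain ⟨p, p1, p2, p3⟩ := exists_polynomial_isLowerSet hD
    refine ⟨fun n => ((p.eval (n : ℚ) : ℚ) : ℝ), ?_, ?_⟩
    · have := tendsto_eval_div_pow p1
      rw [p2, if_neg hu] at this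
      simpa [if_neg hu] using this
    · filter_upwards [p3] with n hn
      rw [← hn, Rat.cast_natCast]
      refine Nat.cast_le.mpr (Set.ncard_le_ncard (fun a ha => ⟨ha.1, setOf_weight_lt_subset hs n ha.2⟩)
        ((finite_setOf_sum_lt d n).subset fun a ha => ha.2))

end Asymptotics

/-! ### Bounding `φ(n)` by standard elements. -/

section ValueCount

open ValueSemigroup

variable {R : Type*} [CommRing R] [IsLocalRing R] {K : Type*} [Field K] [Algebra R K]
  [IsFractionRing R K] {ν : AddValuation K (WithTop ℝ)} {d t : ℕ}

theorem ValueSemigroup.Dominates.phi_le_sum (hν : Dominates R ν)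
    (h1 : IsLeast (valueSemigroup R ν) 1) {y : Fin d → R} {g : Fin t → R} {δ : Fin t → ℕ}
    (h : GeneratesPowers y g δ) {s : Fin d → ℝ}
    (hy : ∀ i, (s i : WithTop ℝ) ≤ ν (algebraMap R K (y i))) (hs : ∀ i, 1 ≤ s i) (n : ℕ) :
    phi R ν n ≤ ((∑ j, {a | a ∈ {a | (monoIdx j a).IsStd y g δ} ∧ ∑ i, a i * s i < n}.ncard : ℕ) :
      ℕ∞) := by
  refine (hν.phi_le n).trans ((h.length_le (hν.pow_le_idealGE h1 n)).trans ?_)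
  rw [ncard_monoIdx ((MonoIdx.finite_deg_lt δ n).subset fun p hp => hp.2.2)]
  refine Nat.cast_le.mpr (Finset.sum_le_sum fun j _ => ?_)
  refine Set.ncard_le_ncard (fun a ha => ⟨ha.1, ?_⟩)
    ((finite_setOf_sum_lt d n).subset fun a ha => setOf_weight_lt_subset hs n ha.2)
  -- The value of `g_j` is only known to be nonnegative: if `y^a` alone has value at least `n`, then
  -- `y^a g_j` lies in `I_n`.
  by_contra! hle
  refine ha.2.1 ?_
  rw [elt_monoIdx]
  refine Ideal.mul_mem_right _ _ (Dominates.mem_idealGE.mpr ?_)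
  exact (WithTop.coe_le_coe.mpr hle).trans (le_valuation_monomialAt hy a)

theorem ValueSemigroup.Dominates.limsup_phi_le (hν : Dominates R ν)
    (h1 : IsLeast (valueSemigroup R ν) 1) {y : Fin d → R} {g : Fin t → R} {δ : Fin t → ℕ}
    (h : GeneratesPowers y g δ) {s : Fin d → ℝ}
    (hy : ∀ i, (s i : WithTop ℝ) ≤ ν (algebraMap R K (y i))) (hs : ∀ i, 1 ≤ s i) :
    limsup (fun n : ℕ => (phi R ν n : ℝ≥0∞) / (n : ℝ≥0∞) ^ d) atTop ≤
      ENNReal.ofReal ((h.rank : ℝ) / ((d ! : ℝ) * ∏ i, s i)) := by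
  classical
  choose b hb1 hb2 using fun j => exists_weighted_count_bound (h.isLowerSet j) hs
  have hlim : Tendsto (fun n : ℕ => (∑ j, b j n) / (n : ℝ) ^ d) atTop
      (𝓝 ((h.rank : ℝ) / ((d ! : ℝ) * ∏ i, s i))) := by
    have := tendsto_finsetSum Finset.univ fun j _ => hb1 j
    simp_rw [← Finset.sum_div] at this
    rwa [← Finset.sum_filter, Finset.sum_const, nsmul_eq_mul, ← div_eq_mul_inv] at this
  rw [← ((ENNReal.continuous_ofReal.tendsto _).comp hlim).limsup_eq]
  refine limsup_le_limsup ?_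
  filter_upwards [eventually_all.mpr hb2, eventually_ge_atTop 1] with n hn hn1
  have hn0 : (0 : ℝ) < (n : ℝ) ^ d := by positivity
  rw [Function.comp, ENNReal.ofReal_div_of_pos hn0, ENNReal.ofReal_pow (Nat.cast_nonneg n),
    ENNReal.ofReal_natCast]
  gcongr
  have h2 := ENat.toENNReal_le.mpr (hν.phi_le_sum h1 h hy hs n)
  refine h2.trans ?_
  rw [ENat.toENNReal_coe, ← ENNReal.ofReal_natCast]
  refine ENNReal.ofReal_le_ofReal ?_
  push_cast
  exact Finset.sum_le_sum fun j _ => hn j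

end ValueCount

/-! ### The main theorem. -/

theorem corollary3
    {R : Type*} [CommRing R] [IsDomain R] [IsLocalRing R] [IsNoetherianRing R]
    {K : Type*} [Field K] [Algebra R K] [IsFractionRing R K]
    {k : Type*} [Field k] [Infinite k] [Algebra k R]
    (hk : Function.Bijective (algebraMap k (ResidueField R)))
    (ν : AddValuation K (WithTop ℝ))
    (hν : ValueSemigroup.Dominates R ν)
    (hV : Function.Bijective hν.residueFieldMap)
    (h1 : IsLeast (ValueSemigroup.valueSemigroup R ν) 1)
    (d : ℕ) (hd : ringKrullDim R = d)
    (s : Fin d → ℝ)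
    (hs : ValueSemigroup.IsFirstElements (ValueSemigroup.valueSemigroup R ν) s) :
    limsup (fun n : ℕ => (ValueSemigroup.phi R ν n : ℝ≥0∞) / (n : ℝ≥0∞) ^ d) atTop ≤
        ENNReal.ofReal ((ValueSemigroup.multiplicity R : ℝ) / ((d ! : ℝ) * ∏ i, s i)) ∧
      (1 < d →
        limsup (fun n : ℕ => (ValueSemigroup.phi R ν n : ℝ≥0∞) / (n : ℝ≥0∞) ^ d) atTop <
          ENNReal.ofReal ((ValueSemigroup.multiplicity R : ℝ) / (d ! : ℝ))) ∧
      Tendsto (fun n : ℕ =>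
          (((ValueSemigroup.hilbertSamuelPoly R).eval (n : ℚ) : ℚ) : ℝ) / (n : ℝ) ^ d) atTop
        (𝓝 ((ValueSemigroup.multiplicity R : ℝ) / (d ! : ℝ))) := by
  have : Infinite (ResidueField R) := Infinite.of_injective _ hk.injective
  obtain ⟨⟨y₀, hy₀⟩, hmin⟩ := exists_minimal_reduction (R := R) hd
  obtain ⟨y, hspan, hy⟩ := hν.exists_generators_le hV.surjective hs y₀ hy₀.1
  -- The elimination preserves the ideal, so the new generators still generate a minimal reduction.
  rw [← hspan] at hy₀
  obtain ⟨t, g, δ, h, hg, hδ⟩ := exists_generatesPowers hy₀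
  have hpos := h.rank_pos (GeneratesPowers.isStd_zero hy₀ hmin hg hδ)
  have hs1 : ∀ i, 1 ≤ s i := fun i => h1.2 (hs i).1.1
  obtain ⟨p, p1, p2, p3⟩ := h.exists_polynomial
  have hp := hilbertSamuelPoly_eq p3
  have hdim : ValueSemigroup.dim R = d := by
    rw [ValueSemigroup.dim, hd]
    rfl
  have hmult : ValueSemigroup.multiplicity R = h.rank := by
    rw [ValueSemigroup.multiplicity, hdim, hp, p2]
    field_simp
  have hle := hν.limsup_phi_le h1 h hy hs1
  rw [hmult, hp]
  refine ⟨by simpa using hle, fun hd1 => hle.trans_lt ?_, ?_⟩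
  · have hprod : 1 < ∏ i, s i := by
      have hlt : s ⟨0, by omega⟩ < s ⟨1, hd1⟩ := hs.strictMono (by simp)
      calc (1 : ℝ) = ∏ _i : Fin d, (1 : ℝ) := by simp
        _ < ∏ i, s i := Finset.prod_lt_prod (fun _ _ => one_pos) (fun i _ => hs1 i)
          ⟨⟨1, hd1⟩, Finset.mem_univ _, (hs1 _).trans_lt hlt⟩
    have hrank : (0 : ℝ) < h.rank := by exact_mod_cast hpos
    have hfac : (0 : ℝ) < d ! := by positivity
    rw [Rat.cast_natCast]
    refine (ENNReal.ofReal_lt_ofReal_iff (by positivity)).mpr ?_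
    exact div_lt_div_of_pos_left hrank hfac (lt_mul_of_one_lt_right hfac hprod)
  · have := tendsto_eval_div_pow p1
    rw [p2] at this
    simpa [div_eq_mul_inv] using this
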